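/- Let $q=e^{2\pi i\tau}$, let prime denote $q\,\frac{d}{dq}=\frac1{2\pi i}\frac{d}{d\tau}$, and for $\operatorname{Im}\tau>0$ let $$E_{1,3}(\tau)=\sum_{(\alpha,\beta)\in\mathbb Z^2}q^{\alpha^2-\alpha\beta+\beta^2}.$$ For a function $f(\tau)$ put $$I_1=\frac{ff''-2f'^2}{f^6},\quad J_1=\frac{f^2f'''-9ff'f''+12f'^3}{f^9}\quad(f\ne0),$$ $$P_1=\frac{(f^2f'''-9ff'f''+12f'^3)^2}{(ff''-2f'^2)^3},\quad Q_1=\frac{f^2\,(2ff''''-32f'f'''+36f''^2)}{(ff''-2f'^2)^2}\quad(ff''-2f'^2\neq0).$$ Let $G_1$ (resp. $\mathcal G_1$) be the group of point transformations $\tilde\tau=\frac{a\tau+b}{c\tau+d}$, $\tilde f=(c\tau+d)f$ with $\begin{pmatrix}a&b\\c&d\end{pmatrix}\in \mathrm{SL}(2,\mathbb R)$ (resp. $\mathrm{GL}(2,\mathbb R)$). An ODE is called invariant under the group if, for every open $U\subset\mathbb C$ on which $c\tau+d$ has no zero, $f$ is a holomorphic solution on $U$ if and only if $\tilde f$ is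 a holomorphic solution on the image of $U$. (i) The series $E_{1,3}$ converges absolutely on the upper half-plane, and there are holomorphic functions $M,N$ there such that $f=E_{1,3}$ satisfies Huber's system $$f'=\frac{Mf-N}3,\qquad M'=\frac{M^2-Nf}3,\qquad N'=(M-f^2)N. \tag{H}$$ (ii) Whenever holomorphic functions $f,M,N$ on an open set $U\subset\mathbb C$ satisfy (H), $f$ satisfies on $U$ the third-order ODE $$f^2f'''^2-6f'(3ff''-4f'^2)f'''+18ff''^3-(f^6+27f'^2)f''^2+4f^5f'^2f''-4f^4f'^4=0. \tag{A}$$ In particular $f=E_{1,3}$ satisfies (A) on the upper half-plane. Equation (A) is $G_1$-invariant, and where $f\ne0$ it is equivalent to $J_1^2+18I_1^3-I_1^2=0$; this relation therefore holds for $E_{1,3}$ wherever $E_{1,3}\neq0$. (iii) The fourth-order ODE $$ff''''(ff''-2f'^2)-f^2f'''^2+2f'(ff''+4f'^2)f'''-9f'^2f''^2=0 \tag{B}$$ is a differential consequence of (A): every holomorphic solution $f$ of (A) on a connected open set $U\subset\mathbb C$, other than the singular solutions (those with $I_1=\frac1{18}$ at all points of $U$ where $f\ne0$), satisfies (B) on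 $U$. Moreover $f=E_{1,3}$ satisfies (B) on the upper half-plane. Equation (B) is $\mathcal G_1$-invariant, and where $f\ne0$ and $ff''-2f'^2\ne0$ it is equivalent to $Q_1-2P_1-36=0$. For $f=E_{1,3}$ one has $ff''-2f'^2\neq0$ and $Q_1-2P_1-36=0$ at every point of the upper half-plane. -/

import Mathlib

open UpperHalfPlane (upperHalfPlaneSet)

/-- The derivation `' = (1 / (2πi)) d/dτ = q d/dq`, where `q = exp (2πiτ)`. -/
noncomputable def qDeriv (f : ℂ → ℂ) (τ : ℂ) : ℂ :=
  (2 * Real.pi * Complex.I)⁻¹ * deriv f τ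

/-- The jet `(f, f', f'', f''', …)` of `f` at `τ`; primes are iterates of `qDeriv`. -/
noncomputable def qJet (f : ℂ → ℂ) (τ : ℂ) : ℕ → ℂ :=
  fun n => (qDeriv^[n] f) τ

/-- The Eisenstein series
`E_{1,3}(τ) = ∑_{(α,β) ∈ ℤ²} q^(α² - αβ + β²)`, `q = exp (2πiτ)`, for `Im τ > 0`. -/
noncomputable def E13 (τ : ℂ) : ℂ :=
  ∑' p : ℤ × ℤ,
    Complex.exp (2 * Real.pi * Complex.I * τ * ((p.1 ^ 2 - p.1 * p.2 + p.2 ^ 2 : ℤ) : ℂ))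

/-- `f` is a holomorphic solution on `U` of the ODE `F(f, f', f'', …) = 0`. An ODE is given by its
left-hand side, a function of the jet variables `y 0 = f, y 1 = f', y 2 = f'', …`. -/
def IsSolutionOn (F : (ℕ → ℂ) → ℂ) (f : ℂ → ℂ) (U : Set ℂ) : Prop :=
  DifferentiableOn ℂ f U ∧ ∀ τ ∈ U, F (qJet f τ) = 0

/-- Huber's system for three holomorphic functions `f, M, N` on `U`. -/
def IsHuberSolutionOn (f M N : ℂ → ℂ) (U : Set ℂ) : Prop :=
  DifferentiableOn ℂ f U ∧ DifferentiableOn ℂ M U ∧ DifferentiableOn ℂ N U ∧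
  ∀ τ ∈ U,
    qDeriv f τ = (M τ * f τ - N τ) / 3 ∧
    qDeriv M τ = (M τ ^ 2 - N τ * f τ) / 3 ∧
    qDeriv N τ = (M τ - f τ ^ 2) * N τ

/-- Left-hand side of the third-order ODE
`f²f'''² - 6f'(3ff'' - 4f'²)f''' + 18ff''³ - (f⁶ + 27f'²)f''² + 4f⁵f'²f'' - 4f⁴f'⁴ = 0`. -/
def ode3 (y : ℕ → ℂ) : ℂ :=
  y 0 ^ 2 * y 3 ^ 2 - 6 * y 1 * (3 * y 0 * y 2 - 4 * y 1 ^ 2) * y 3 + 18 * y 0 * y 2 ^ 3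
    - (y 0 ^ 6 + 27 * y 1 ^ 2) * y 2 ^ 2 + 4 * y 0 ^ 5 * y 1 ^ 2 * y 2 - 4 * y 0 ^ 4 * y 1 ^ 4

/-- Left-hand side of the fourth-order ODE
`ff''''(ff'' - 2f'²) - f²f'''² + 2f'(ff'' + 4f'²)f''' - 9f'²f''² = 0`. -/
def ode4 (y : ℕ → ℂ) : ℂ :=
  y 0 * y 4 * (y 0 * y 2 - 2 * y 1 ^ 2) - y 0 ^ 2 * y 3 ^ 2
    + 2 * y 1 * (y 0 * y 2 + 4 * y 1 ^ 2) * y 3 - 9 * y 1 ^ 2 * y 2 ^ 2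

/-- `kff'' - (k+1)f'²`. -/
def bracketTwo (k : ℂ) (y : ℕ → ℂ) : ℂ :=
  k * y 0 * y 2 - (k + 1) * y 1 ^ 2

/-- `k²f²f''' - 3k(k+2)ff'f'' + 2(k+1)(k+2)f'³`. -/
def bracketThree (k : ℂ) (y : ℕ → ℂ) : ℂ :=
  k ^ 2 * y 0 ^ 2 * y 3 - 3 * k * (k + 2) * y 0 * y 1 * y 2 + 2 * (k + 1) * (k + 2) * y 1 ^ 3

/-- The differential invariant `I_k`, meaningful for `k ≠ 0` where `f ≠ 0`. -/
noncomputable def invI (k : ℂ) (y : ℕ → ℂ) : ℂ :=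
  bracketTwo k y / y 0 ^ (2 + 4 / k)

/-- The differential invariant `J_k`, meaningful for `k ≠ 0` where `f ≠ 0`. -/
noncomputable def invJ (k : ℂ) (y : ℕ → ℂ) : ℂ :=
  bracketThree k y / y 0 ^ (3 + 6 / k)

/-- The differential invariant `P_k`, meaningful where `kff'' - (k+1)f'² ≠ 0`. -/
noncomputable def invP (k : ℂ) (y : ℕ → ℂ) : ℂ :=
  bracketThree k y ^ 2 / bracketTwo k y ^ 3

/-- The differential invariant `Q_k`, meaningful where `kff'' - (k+1)f'² ≠ 0`. -/
noncomputable def invQ (k : ℂ) (y : ℕ → ℂ) : ℂ :=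
  y 0 ^ 2 * (k * (k + 1) * y 0 * y 4 - 4 * (k + 1) * (k + 3) * y 1 * y 3
    + 3 * (k + 2) * (k + 3) * y 2 ^ 2) / bracketTwo k y ^ 2

/-- `cτ + d` for the real matrix `A = (a b; c d)`. -/
def autFactor (A : Matrix (Fin 2) (Fin 2) ℝ) (τ : ℂ) : ℂ :=
  (A 1 0 : ℂ) * τ + (A 1 1 : ℂ)

/-- `(aτ + b) / (cτ + d)` for the real matrix `A = (a b; c d)`. -/
noncomputable def moebius (A : Matrix (Fin 2) (Fin 2) ℝ) (τ : ℂ) : ℂ :=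
  ((A 0 0 : ℂ) * τ + (A 0 1 : ℂ)) / autFactor A τ

/-- The ODE `F = 0` is invariant under the point transformations
`τ̃ = (aτ + b)/(cτ + d)`, `f̃ = (cτ + d)^k f` with `(a b; c d) ∈ S`: a function `f` on an open set
`U` on which `cτ + d` does not vanish is a solution if and only if the transformed function `f̃` is
a solution on the image of `U`. -/
def IsInvariantODE (k : ℤ) (S : Set (Matrix (Fin 2) (Fin 2) ℝ)) (F : (ℕ → ℂ) → ℂ) : Prop :=
  ∀ A ∈ S, ∀ U : Set ℂ, IsOpen U → (∀ τ ∈ U, autFactor A τ ≠ 0) →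
    ∀ f g : ℂ → ℂ, (∀ τ ∈ U, g (moebius A τ) = autFactor A τ ^ k * f τ) →
      (IsSolutionOn F f U ↔ IsSolutionOn F g (moebius A '' U))

open Set Filter Topology

/-! Write B₂ = ff'' - 2f'² and B₃ = f²f''' - 9ff'f'' + 12f'³. For f of weight 1 these are covariants
of weights 6 and 9, and B₃ = fB₂' - 6f'B₂. Multiplied by f², (A) becomes B₃² + 18B₂³ = f⁶B₂², and
(B) becomes B₂B₄ + 9B₂³ = B₃² with B₄ = fB₃' - 9f'B₃. Differentiating the first relation gives B₃(B₄
+ 27B₂² - f⁶B₂) = 0, and the identity theorem turns this into (B) away from the singular solutions.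
For Huber's system all derivatives of f are polynomials in f, M, N, so (A) and (B) become polynomial
identities.

The analytic part is that f = E₁,₃ solves the system. Two theta inversions give its behaviour under
τ ↦ -1/(3τ) (`E13_fricke`). In place of dimension formulas stands a maximum principle,
`eq_of_norm_fricke_invariant`: a function holomorphic in |q| < 1 whose norm is invariant under this
map is constant. Applied to B₂⁴/(η(τ)²⁴η(3τ)²⁴), it shows that B₂ has no zeros. Applied to (f⁶B₂² -
18B₂³ - B₃²)/B₂³, which vanishes at q = 0, it gives the algebraic form of (A). From that relation
`exists_isHuberSolutionOn` recovers N = (f³ + B₃/B₂)/2 and M as the logarithmic derivative of f³ -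
N. -/

/-- `f` has derivative `a` at `τ` with respect to the derivation `(1 / (2πi)) d/dτ`. -/
def HasQDerivAt (f : ℂ → ℂ) (a τ : ℂ) : Prop :=
  HasDerivAt f (2 * Real.pi * Complex.I * a) τ

namespace HasQDerivAt

variable {f g : ℂ → ℂ} {a b τ : ℂ}

theorem qDeriv_eq (h : HasQDerivAt f a τ) : qDeriv f τ = a := by
  rw [qDeriv, HasDerivAt.deriv h, inv_mul_cancel_left₀ Complex.two_pi_I_ne_zero]

theorem unique (h : HasQDerivAt f a τ) (h' : HasQDerivAt f b τ) : a = b :=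
  h.qDeriv_eq.symm.trans h'.qDeriv_eq

theorem congr_deriv (h : HasQDerivAt f a τ) (hab : a = b) : HasQDerivAt f b τ := hab ▸ h

theorem const (c τ : ℂ) : HasQDerivAt (fun _ => c) 0 τ := by
  simpa [HasQDerivAt] using hasDerivAt_const τ c

theorem add (hf : HasQDerivAt f a τ) (hg : HasQDerivAt g b τ) :
    HasQDerivAt (fun t => f t + g t) (a + b) τ :=
  (HasDerivAt.fun_add hf hg).congr_deriv (by ring)

theorem sub (hf : HasQDerivAt f a τ) (hg : HasQDerivAt g b τ) :
    HasQDerivAt (fun t => f t - g t) (a - b) τ :=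
  (HasDerivAt.fun_sub hf hg).congr_deriv (by ring)

theorem mul (hf : HasQDerivAt f a τ) (hg : HasQDerivAt g b τ) :
    HasQDerivAt (fun t => f t * g t) (a * g τ + f τ * b) τ :=
  (HasDerivAt.fun_mul hf hg).congr_deriv (by ring)

theorem const_mul (c : ℂ) (hf : HasQDerivAt f a τ) :
    HasQDerivAt (fun t => c * f t) (c * a) τ :=
  (HasDerivAt.const_mul c hf).congr_deriv (by ring)

theorem div_const (hf : HasQDerivAt f a τ) (c : ℂ) :
    HasQDerivAt (fun t => f t / c) (a / c) τ :=
  (HasDerivAt.div_const hf c).congr_deriv (by ring)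

theorem pow (hf : HasQDerivAt f a τ) (n : ℕ) :
    HasQDerivAt (fun t => f t ^ n) (n * f τ ^ (n - 1) * a) τ :=
  (HasDerivAt.fun_pow hf n).congr_deriv (by ring)

theorem congr_of_eqOn {U : Set ℂ} (hf : HasQDerivAt f a τ) (hU : IsOpen U) (hτ : τ ∈ U)
    (h : EqOn g f U) : HasQDerivAt g a τ :=
  HasDerivAt.congr_of_eventuallyEq hf (h.eventuallyEq_of_mem (hU.mem_nhds hτ))

end HasQDerivAt

/-! ### Jets of holomorphic functions -/

section Jets

variable {f g : ℂ → ℂ} {U : Set ℂ} {τ : ℂ}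

theorem DifferentiableAt.hasQDerivAt (h : DifferentiableAt ℂ f τ) :
    HasQDerivAt f (qDeriv f τ) τ := by
  rw [HasQDerivAt, qDeriv, mul_inv_cancel_left₀ Complex.two_pi_I_ne_zero]
  exact h.hasDerivAt

theorem DifferentiableOn.qDeriv (h : DifferentiableOn ℂ f U) (hU : IsOpen U) :
    DifferentiableOn ℂ (qDeriv f) U :=
  (h.deriv hU).const_mul _

@[simp] theorem qJet_zero (f : ℂ → ℂ) (τ : ℂ) : qJet f τ 0 = f τ := rfl

theorem qJet_one (f : ℂ → ℂ) (τ : ℂ) : qJet f τ 1 = qDeriv f τ := rfl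

theorem differentiableOn_qJet (h : DifferentiableOn ℂ f U) (hU : IsOpen U) (n : ℕ) :
    DifferentiableOn ℂ (fun t => qJet f t n) U := by
  induction n with
  | zero => exact h
  | succ n ih =>
    have := ih.qDeriv hU
    simpa only [qJet, Function.iterate_succ_apply'] using! this

theorem hasQDerivAt_qJet (h : DifferentiableOn ℂ f U) (hU : IsOpen U) (hτ : τ ∈ U) (n : ℕ) :
    HasQDerivAt (fun t => qJet f t n) (qJet f τ (n + 1)) τ := by
  have := ((differentiableOn_qJet h hU n).differentiableAt (hU.mem_nhds hτ)).hasQDerivAt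
  simpa only [qJet, Function.iterate_succ_apply'] using! this

theorem qJet_succ_eqOn {n : ℕ} {F G : ℂ → ℂ} (hU : IsOpen U)
    (h : EqOn (fun t => qJet f t n) F U) (hF : ∀ τ ∈ U, HasQDerivAt F (G τ) τ) :
    EqOn (fun t => qJet f t (n + 1)) G U := by
  intro τ hτ
  have := ((hF τ hτ).congr_of_eqOn hU hτ h).qDeriv_eq
  simpa only [qJet, Function.iterate_succ_apply'] using! this

end Jets

/-! ### The two ODEs in terms of covariants -/

section Algebra

theorem sq_mul_ode3 (y : ℕ → ℂ) :
    y 0 ^ 2 * ode3 y =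
      bracketThree 1 y ^ 2 + 18 * bracketTwo 1 y ^ 3 - y 0 ^ 6 * bracketTwo 1 y ^ 2 := by
  simp only [ode3, bracketThree, bracketTwo]; ring

theorem ode3_eq_zero_iff_invariants {y : ℕ → ℂ} (h : y 0 ≠ 0) :
    ode3 y = 0 ↔ invJ 1 y ^ 2 + 18 * invI 1 y ^ 3 - invI 1 y ^ 2 = 0 := by
  have h6 : y 0 ^ (2 + 4 / 1 : ℂ) = y 0 ^ 6 := by
    rw [← Complex.cpow_natCast]; norm_num
  have h9 : y 0 ^ (3 + 6 / 1 : ℂ) = y 0 ^ 9 := by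
    rw [← Complex.cpow_natCast]; norm_num
  have key : invJ 1 y ^ 2 + 18 * invI 1 y ^ 3 - invI 1 y ^ 2 = ode3 y / y 0 ^ 16 := by
    rw [invJ, invI, h6, h9, eq_div_iff (pow_ne_zero _ h)]
    have := sq_mul_ode3 y
    field_simp
    linear_combination -this
  rw [key, div_eq_zero_iff, or_iff_left (pow_ne_zero _ h)]

theorem ode4_eq_zero_iff_invariants {y : ℕ → ℂ} (h : y 0 ≠ 0) (hB : bracketTwo 1 y ≠ 0) :
    ode4 y = 0 ↔ invQ 1 y - 2 * invP 1 y - 36 = 0 := by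
  have key : invQ 1 y - 2 * invP 1 y - 36 = 2 * y 0 ^ 2 * ode4 y / bracketTwo 1 y ^ 3 := by
    rw [invQ, invP, eq_div_iff (pow_ne_zero _ hB)]
    field_simp
    simp only [ode4, bracketThree, bracketTwo]
    ring
  rw [key, div_eq_zero_iff, or_iff_left (pow_ne_zero _ hB), mul_eq_zero,
    or_iff_right (mul_ne_zero two_ne_zero (pow_ne_zero _ h))]

/-- The invariant form of the fourth-order equation also holds at zeros of `f`. -/
theorem invQ_sub_invP_eq_zero {y : ℕ → ℂ} (hB : bracketTwo 1 y ≠ 0) (h : ode4 y = 0) :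
    invQ 1 y - 2 * invP 1 y - 36 = 0 := by
  by_cases h0 : y 0 = 0
  -- At a zero of f, Q = 0 and P = (12f'³)²/(-2f'²)³ = -18, whatever the higher derivatives are.
  · have h1 : y 1 ≠ 0 := fun h1 => hB (by simp [bracketTwo, h0, h1])
    simp only [invQ, invP, bracketTwo, bracketThree, h0]
    field_simp
    ring
  · exact (ode4_eq_zero_iff_invariants h0 hB).1 h

/-- The weighted derivative of `bracketThree 1`. -/
def bracketFour (y : ℕ → ℂ) : ℂ :=
  y 0 * (y 0 ^ 2 * y 4 - 7 * y 0 * y 1 * y 3 - 9 * y 0 * y 2 ^ 2 + 27 * y 1 ^ 2 * y 2)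
    - 9 * y 1 * bracketThree 1 y

theorem sq_mul_ode4 (y : ℕ → ℂ) :
    y 0 ^ 2 * ode4 y =
      bracketTwo 1 y * bracketFour y + 9 * bracketTwo 1 y ^ 3 - bracketThree 1 y ^ 2 := by
  simp only [ode4, bracketFour, bracketThree, bracketTwo]; ring

end Algebra

section Brackets

variable {f : ℂ → ℂ} {U : Set ℂ} {τ : ℂ}

theorem hasQDerivAt_bracketTwo (h : DifferentiableOn ℂ f U) (hU : IsOpen U) (hτ : τ ∈ U) :
    HasQDerivAt (fun t => bracketTwo 1 (qJet f t))
      (qJet f τ 0 * qJet f τ 3 - 3 * qJet f τ 1 * qJet f τ 2) τ := by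
  have d := hasQDerivAt_qJet h hU hτ
  exact ((((d 0).const_mul 1).mul (d 2)).sub (((d 1).pow 2).const_mul (1 + 1))).congr_deriv
    (by push_cast; ring)

theorem hasQDerivAt_bracketThree (h : DifferentiableOn ℂ f U) (hU : IsOpen U) (hτ : τ ∈ U) :
    HasQDerivAt (fun t => bracketThree 1 (qJet f t))
      (qJet f τ 0 ^ 2 * qJet f τ 4 - 7 * qJet f τ 0 * qJet f τ 1 * qJet f τ 3
        - 9 * qJet f τ 0 * qJet f τ 2 ^ 2 + 27 * qJet f τ 1 ^ 2 * qJet f τ 2) τ := by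
  have d := hasQDerivAt_qJet h hU hτ
  exact ((((((d 0).pow 2).const_mul (1 ^ 2)).mul (d 3)).sub
    ((((d 0).const_mul (3 * 1 * (1 + 2))).mul (d 1)).mul (d 2))).add
    (((d 1).pow 3).const_mul (2 * (1 + 1) * (1 + 2)))).congr_deriv
    (by push_cast; ring)

theorem differentiableOn_bracketTwo (h : DifferentiableOn ℂ f U) (hU : IsOpen U) :
    DifferentiableOn ℂ (fun t => bracketTwo 1 (qJet f t)) U := fun _ hτ =>
  (HasDerivAt.differentiableAt (hasQDerivAt_bracketTwo h hU hτ)).differentiableWithinAt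

theorem differentiableOn_bracketThree (h : DifferentiableOn ℂ f U) (hU : IsOpen U) :
    DifferentiableOn ℂ (fun t => bracketThree 1 (qJet f t)) U := fun _ hτ =>
  (HasDerivAt.differentiableAt (hasQDerivAt_bracketThree h hU hτ)).differentiableWithinAt

end Brackets

/-! ### Elimination of M and N from Huber's system -/

section Huber

variable {f M N : ℂ → ℂ} {U : Set ℂ}

/-- The system expresses the derivative of any polynomial in f, M, N as another such polynomial.
Four rounds suffice to turn both ODEs into polynomial identities. -/
theorem IsHuberSolutionOn.qJet_eq (hU : IsOpen U) (h : IsHuberSolutionOn f M N U) :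
    EqOn (fun t => qJet f t 1) (fun t => (M t * f t - N t) / 3) U ∧
    EqOn (fun t => qJet f t 2)
      (fun t => (2 * M t ^ 2 * f t - 4 * M t * N t + 2 * N t * f t ^ 2) / 9) U ∧
    EqOn (fun t => qJet f t 3)
      (fun t => (6 * M t ^ 3 * f t + 18 * M t * N t * f t ^ 2 - 6 * f t ^ 4 * N t
        - 18 * M t ^ 2 * N t) / 27) U ∧
    EqOn (fun t => qJet f t 4)
      (fun t => (24 * M t ^ 4 * f t + 144 * M t ^ 2 * N t * f t ^ 2 - 96 * M t * f t ^ 4 * N t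
        - 96 * M t ^ 3 * N t + 6 * N t ^ 2 * f t ^ 3 + 18 * f t ^ 6 * N t) / 81) U := by
  obtain ⟨hf, hM, hN, heq⟩ := h
  have df : ∀ τ ∈ U, HasQDerivAt f ((M τ * f τ - N τ) / 3) τ := fun τ hτ =>
    (hf.differentiableAt (hU.mem_nhds hτ)).hasQDerivAt.congr_deriv (heq τ hτ).1
  have dM : ∀ τ ∈ U, HasQDerivAt M ((M τ ^ 2 - N τ * f τ) / 3) τ := fun τ hτ =>
    (hM.differentiableAt (hU.mem_nhds hτ)).hasQDerivAt.congr_deriv (heq τ hτ).2.1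
  have dN : ∀ τ ∈ U, HasQDerivAt N ((M τ - f τ ^ 2) * N τ) τ := fun τ hτ =>
    (hN.differentiableAt (hU.mem_nhds hτ)).hasQDerivAt.congr_deriv (heq τ hτ).2.2
  have h1 := qJet_succ_eqOn (f := f) (n := 0) hU (fun _ _ => rfl) df
  have h2 := qJet_succ_eqOn (n := 1)
    (G := fun t => (2 * M t ^ 2 * f t - 4 * M t * N t + 2 * N t * f t ^ 2) / 9) hU h1 fun τ hτ =>
      ((((dM τ hτ).mul (df τ hτ)).sub (dN τ hτ)).div_const 3).congr_deriv (by ring)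
  have h3 := qJet_succ_eqOn (n := 2)
    (G := fun t => (6 * M t ^ 3 * f t + 18 * M t * N t * f t ^ 2 - 6 * f t ^ 4 * N t
        - 18 * M t ^ 2 * N t) / 27) hU h2 fun τ hτ =>
      ((((((dM τ hτ).pow 2).const_mul 2).mul (df τ hτ)).sub
        (((dM τ hτ).const_mul 4).mul (dN τ hτ))).add
        (((dN τ hτ).const_mul 2).mul ((df τ hτ).pow 2))).div_const 9 |>.congr_deriv
        (by push_cast; ring)
  have h4 := qJet_succ_eqOn (n := 3)
    (G := fun t => (24 * M t ^ 4 * f t + 144 * M t ^ 2 * N t * f t ^ 2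
        - 96 * M t * f t ^ 4 * N t - 96 * M t ^ 3 * N t + 6 * N t ^ 2 * f t ^ 3
        + 18 * f t ^ 6 * N t) / 81) hU h3 fun τ hτ =>
      (((((((dM τ hτ).pow 3).const_mul 6).mul (df τ hτ)).add
        ((((dM τ hτ).const_mul 18).mul (dN τ hτ)).mul ((df τ hτ).pow 2))).sub
        ((((df τ hτ).pow 4).const_mul 6).mul (dN τ hτ))).sub
        ((((dM τ hτ).pow 2).const_mul 18).mul (dN τ hτ))).div_const 27 |>.congr_deriv
        (by push_cast; ring)
  exact ⟨h1, h2, h3, h4⟩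

theorem IsHuberSolutionOn.isSolutionOn_ode3 (hU : IsOpen U) (h : IsHuberSolutionOn f M N U) :
    IsSolutionOn ode3 f U := by
  refine ⟨h.1, fun τ hτ => ?_⟩
  obtain ⟨h1, h2, h3, -⟩ := h.qJet_eq hU
  replace h1 := h1 hτ
  replace h2 := h2 hτ
  replace h3 := h3 hτ
  simp only at h1 h2 h3
  simp only [ode3, h1, h2, h3, qJet_zero]
  ring

theorem IsHuberSolutionOn.isSolutionOn_ode4 (hU : IsOpen U) (h : IsHuberSolutionOn f M N U) :
    IsSolutionOn ode4 f U := by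
  refine ⟨h.1, fun τ hτ => ?_⟩
  obtain ⟨h1, h2, h3, h4⟩ := h.qJet_eq hU
  replace h1 := h1 hτ
  replace h2 := h2 hτ
  replace h3 := h3 hτ
  replace h4 := h4 hτ
  simp only at h1 h2 h3 h4
  simp only [ode4, h1, h2, h3, h4, qJet_zero]
  ring

end Huber

/-! ### The fourth-order ODE as a differential consequence -/

section Consequence

variable {f g : ℂ → ℂ} {U : Set ℂ}

theorem eqOn_zero_or_eqOn_zero_of_mul (hU : IsOpen U) (hc : IsPreconnected U)
    (hf : DifferentiableOn ℂ f U) (hg : DifferentiableOn ℂ g U)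
    (h : ∀ τ ∈ U, f τ * g τ = 0) : (∀ τ ∈ U, f τ = 0) ∨ ∀ τ ∈ U, g τ = 0 :=
  (hf.analyticOnNhd hU).eq_zero_or_eq_zero_of_smul_eq_zero (hg.analyticOnNhd hU) h hc

/-- A solution of the third-order equation on a connected open set solves the fourth-order one,
unless `18 (f f'' - 2 f'^2) = f ^ 6` identically. -/
theorem IsSolutionOn.ode4_of_ode3 (hU : IsOpen U) (hc : IsPreconnected U)
    (h : IsSolutionOn ode3 f U)
    (hns : ∃ τ ∈ U, f τ ≠ 0 ∧ invI 1 (qJet f τ) ≠ 1 / 18) : IsSolutionOn ode4 f U := by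
  obtain ⟨hf, hode⟩ := h
  refine ⟨hf, ?_⟩
  obtain ⟨τ₀, hτ₀, hf₀, hI⟩ := hns
  have dj := fun n => differentiableOn_qJet hf hU n
  have d2 := differentiableOn_bracketTwo hf hU
  have d3 := differentiableOn_bracketThree hf hU
  have d4 : DifferentiableOn ℂ (fun t => bracketFour (qJet f t)) U := by
    have h0 := dj 0
    have h1 := dj 1
    have h2 := dj 2
    have h3 := dj 3
    have h4 := dj 4
    unfold bracketFour
    fun_prop
  have dode : DifferentiableOn ℂ (fun t => ode4 (qJet f t)) U := by
    have h0 := dj 0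
    have h1 := dj 1
    have h2 := dj 2
    have h3 := dj 3
    have h4 := dj 4
    unfold ode4
    fun_prop
  have cancel : ∀ {g : ℂ → ℂ}, DifferentiableOn ℂ g U → (∀ τ ∈ U, f τ * g τ = 0) →
      ∀ τ ∈ U, g τ = 0 := fun hg h =>
    (eqOn_zero_or_eqOn_zero_of_mul hU hc hf hg h).resolve_left fun h0 => hf₀ (h0 τ₀ hτ₀)
  have rel : ∀ τ ∈ U, bracketThree 1 (qJet f τ) ^ 2 + 18 * bracketTwo 1 (qJet f τ) ^ 3
      - f τ ^ 6 * bracketTwo 1 (qJet f τ) ^ 2 = 0 := fun τ hτ => by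
    have := sq_mul_ode3 (qJet f τ)
    rw [hode τ hτ, mul_zero, qJet_zero] at this
    exact this.symm
  have drel : ∀ τ ∈ U, bracketThree 1 (qJet f τ) * (bracketFour (qJet f τ)
      + 27 * bracketTwo 1 (qJet f τ) ^ 2 - f τ ^ 6 * bracketTwo 1 (qJet f τ)) = 0 := by
    intro τ hτ
    have e := (((((hasQDerivAt_bracketThree hf hU hτ).pow 2).add
      (((hasQDerivAt_bracketTwo hf hU hτ).pow 3).const_mul 18)).sub
      (((hasQDerivAt_qJet hf hU hτ 0).pow 6).mul
        ((hasQDerivAt_bracketTwo hf hU hτ).pow 2))).congr_of_eqOn hU hτ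
        (g := fun _ => 0) (fun t ht => (rel t ht).symm)).unique (HasQDerivAt.const 0 τ)
    have r := rel τ hτ
    simp only [bracketFour, bracketTwo, bracketThree, qJet_zero, zero_add] at e r ⊢
    push_cast at e
    -- Since fB₂' = B₃ + 6f'B₂ and fB₃' = B₄ + 9f'B₃, f/2 times the differentiated relation is the
    -- target plus 9f' times the relation itself.
    linear_combination (f τ / 2) * e - 9 * qJet f τ 1 * r
  have dX : DifferentiableOn ℂ (fun t => bracketFour (qJet f t)
      + 27 * bracketTwo 1 (qJet f t) ^ 2 - f t ^ 6 * bracketTwo 1 (qJet f t)) U := by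
    fun_prop
  rcases eqOn_zero_or_eqOn_zero_of_mul hU hc d3 dX drel with h3 | hX
  -- If B₃ ≡ 0, the relation reads B₂²(18B₂ - f⁶) = 0. The second factor vanishes identically only
  -- for singular solutions, so B₂ ≡ 0.
  · have hB : ∀ τ ∈ U, bracketTwo 1 (qJet f τ) = 0 := by
      have dY : DifferentiableOn ℂ (fun t => 18 * bracketTwo 1 (qJet f t) - f t ^ 6) U := by
        fun_prop
      have d22 : DifferentiableOn ℂ (fun t => bracketTwo 1 (qJet f t) ^ 2) U := by fun_prop
      refine (eqOn_zero_or_eqOn_zero_of_mul hU hc d22 dY fun τ hτ => ?_).elim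
        (fun h τ hτ => pow_eq_zero_iff two_ne_zero |>.1 (h τ hτ)) fun h => (hI ?_).elim
      · have := rel τ hτ
        rw [h3 τ hτ] at this
        linear_combination this
      · have h6 : f τ₀ ^ (2 + 4 / 1 : ℂ) = f τ₀ ^ 6 := by
          rw [← Complex.cpow_natCast]; norm_num
        rw [invI, qJet_zero, h6, div_eq_div_iff (pow_ne_zero _ hf₀) (by norm_num)]
        linear_combination h τ₀ hτ₀
    have h2 : ∀ τ ∈ U, f τ * ode4 (qJet f τ) = 0 := cancel (hf.mul dode) fun τ hτ => by
      have := sq_mul_ode4 (qJet f τ)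
      rw [hB τ hτ, h3 τ hτ, qJet_zero] at this
      linear_combination this
    exact cancel dode h2
  -- Here B₄ can be eliminated: B₂B₄ + 9B₂³ - B₃² becomes f⁶B₂² - 18B₂³ - B₃² = 0.
  · have h2 : ∀ τ ∈ U, f τ * ode4 (qJet f τ) = 0 := cancel (hf.mul dode) fun τ hτ => by
      have := sq_mul_ode4 (qJet f τ)
      rw [qJet_zero] at this
      linear_combination this + bracketTwo 1 (qJet f τ) * hX τ hτ - rel τ hτ
    exact cancel dode h2

end Consequence

/-! ### Point transformations and invariance -/

section Moebius

variable {A : Matrix (Fin 2) (Fin 2) ℝ} {U : Set ℂ} {τ : ℂ}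

theorem autFactor_inv_moebius (hA : A.det ≠ 0) (hτ : autFactor A τ ≠ 0) :
    autFactor A⁻¹ (moebius A τ) = (autFactor A τ)⁻¹ := by
  have hd : (A 0 0 * A 1 1 - A 0 1 * A 1 0 : ℂ) ≠ 0 := by
    rw [Matrix.det_fin_two] at hA; exact_mod_cast hA
  refine eq_inv_of_mul_eq_one_left ?_
  rw [moebius, Matrix.inv_def, Matrix.adjugate_fin_two]
  simp only [autFactor, Matrix.det_fin_two, Ring.inverse_eq_inv'] at hτ ⊢
  simp
  field_simp
  ring

theorem moebius_inv_moebius (hA : A.det ≠ 0) (hτ : autFactor A τ ≠ 0) :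
    moebius A⁻¹ (moebius A τ) = τ := by
  have hd : (A 0 0 * A 1 1 - A 0 1 * A 1 0 : ℂ) ≠ 0 := by
    rw [Matrix.det_fin_two] at hA; exact_mod_cast hA
  rw [moebius, autFactor_inv_moebius hA hτ, div_inv_eq_mul, moebius, Matrix.inv_def,
    Matrix.adjugate_fin_two]
  simp only [autFactor, Matrix.det_fin_two, Ring.inverse_eq_inv'] at hτ ⊢
  simp
  field_simp
  ring

theorem det_inv_ne_zero (hA : A.det ≠ 0) : A⁻¹.det ≠ 0 := by
  rw [Matrix.det_nonsing_inv, Ring.inverse_eq_inv']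
  exact inv_ne_zero hA

theorem autFactor_inv_ne_zero (hA : A.det ≠ 0) (hU : ∀ τ ∈ U, autFactor A τ ≠ 0) :
    ∀ w ∈ moebius A '' U, autFactor A⁻¹ w ≠ 0 := by
  rintro _ ⟨τ, hτ, rfl⟩
  rw [autFactor_inv_moebius hA (hU τ hτ)]
  exact inv_ne_zero (hU τ hτ)

theorem image_moebius_inv_image (hA : A.det ≠ 0) (hU : ∀ τ ∈ U, autFactor A τ ≠ 0) :
    moebius A⁻¹ '' (moebius A '' U) = U := by
  rw [image_image, image_congr fun τ hτ => moebius_inv_moebius hA (hU τ hτ), image_id']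

theorem differentiable_autFactor (A : Matrix (Fin 2) (Fin 2) ℝ) :
    Differentiable ℂ (autFactor A) := by
  unfold autFactor; fun_prop

theorem hasDerivAt_autFactor (A : Matrix (Fin 2) (Fin 2) ℝ) (τ : ℂ) :
    HasDerivAt (autFactor A) (A 1 0) τ :=
  (((hasDerivAt_id τ).const_mul (A 1 0 : ℂ)).add_const (A 1 1 : ℂ)).congr_deriv (mul_one _)

theorem hasDerivAt_moebius (hτ : autFactor A τ ≠ 0) :
    HasDerivAt (moebius A) (A.det / autFactor A τ ^ 2) τ := by
  have h1 : HasDerivAt (fun t : ℂ => (A 0 0 : ℂ) * t + (A 0 1 : ℂ)) (A 0 0) τ := by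
    simpa using ((hasDerivAt_id τ).const_mul (A 0 0 : ℂ)).add_const (A 0 1 : ℂ)
  refine (h1.div (hasDerivAt_autFactor A τ) hτ).congr_deriv ?_
  rw [Matrix.det_fin_two, autFactor]
  push_cast
  ring

theorem isOpen_image_moebius (hA : A.det ≠ 0) (hUo : IsOpen U)
    (hU : ∀ τ ∈ U, autFactor A τ ≠ 0) : IsOpen (moebius A '' U) := by
  have hV : IsOpen {w | autFactor A⁻¹ w ≠ 0} :=
    isOpen_ne_fun (differentiable_autFactor _).continuous continuous_const
  have hc : ContinuousOn (moebius A⁻¹) {w | autFactor A⁻¹ w ≠ 0} := fun w hw =>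
    (hasDerivAt_moebius hw).continuousAt.continuousWithinAt
  convert hc.isOpen_inter_preimage hV hUo using 1
  ext w
  constructor
  · rintro ⟨τ, hτ, rfl⟩
    refine ⟨autFactor_inv_ne_zero hA hU _ ⟨τ, hτ, rfl⟩, ?_⟩
    rwa [mem_preimage, moebius_inv_moebius hA (hU τ hτ)]
  · rintro ⟨hw, hwU⟩
    refine ⟨_, hwU, ?_⟩
    have := moebius_inv_moebius (det_inv_ne_zero hA) hw
    rwa [Matrix.nonsing_inv_nonsing_inv _ (isUnit_iff_ne_zero.2 hA)] at this

theorem differentiableOn_image_moebius {f g : ℂ → ℂ} (hA : A.det ≠ 0)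
    (hU : ∀ τ ∈ U, autFactor A τ ≠ 0) (hf : DifferentiableOn ℂ f U)
    (hg : ∀ τ ∈ U, g (moebius A τ) = autFactor A τ * f τ) :
    DifferentiableOn ℂ g (moebius A '' U) := by
  have hinv := autFactor_inv_ne_zero hA hU
  have hm : MapsTo (moebius A⁻¹) (moebius A '' U) U := by
    rintro _ ⟨τ, hτ, rfl⟩
    rwa [moebius_inv_moebius hA (hU τ hτ)]
  have hd : DifferentiableOn ℂ (moebius A⁻¹) (moebius A '' U) := fun w hw =>
    (hasDerivAt_moebius (hinv w hw)).differentiableAt.differentiableWithinAt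
  refine ((((differentiable_autFactor A).differentiableOn.mul hf).comp hd hm)).congr ?_
  rintro _ ⟨τ, hτ, rfl⟩
  simp only [Function.comp_apply, Pi.mul_apply]
  rw [moebius_inv_moebius hA (hU τ hτ), hg τ hτ]

theorem hasQDerivAt_autFactor (A : Matrix (Fin 2) (Fin 2) ℝ) (τ : ℂ) :
    HasQDerivAt (autFactor A) (A 1 0 / (2 * Real.pi * Complex.I)) τ := by
  rw [HasQDerivAt, mul_div_cancel₀ _ Complex.two_pi_I_ne_zero]
  exact hasDerivAt_autFactor A τ

/-- The derivation `qDeriv` in the coordinate `moebius A τ` is `(cτ + d)² / det A` times the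
derivation in the coordinate `τ`. -/
theorem qJet_succ_moebius {g Φ : ℂ → ℂ} {φ : ℂ} {n : ℕ} (hA : A.det ≠ 0) (hUo : IsOpen U)
    (hU : ∀ τ ∈ U, autFactor A τ ≠ 0) (hg : DifferentiableOn ℂ g (moebius A '' U))
    (h : ∀ τ ∈ U, qJet g (moebius A τ) n = Φ τ) (hτ : τ ∈ U) (hΦ : HasQDerivAt Φ φ τ) :
    qJet g (moebius A τ) (n + 1) = autFactor A τ ^ 2 / A.det * φ := by
  have hVo := isOpen_image_moebius hA hUo hU
  have h1 := HasDerivAt.comp τ (hasQDerivAt_qJet hg hVo (mem_image_of_mem _ hτ) n)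
    (hasDerivAt_moebius (hU τ hτ))
  have h2 : HasDerivAt ((fun t => qJet g t n) ∘ moebius A) (2 * Real.pi * Complex.I * φ) τ :=
    HasQDerivAt.congr_of_eqOn hΦ hUo hτ h
  have h3 := h1.unique h2
  have hd : (A.det : ℂ) ≠ 0 := by exact_mod_cast hA
  have hJ := hU τ hτ
  rw [mul_assoc] at h3
  have h4 := mul_left_cancel₀ Complex.two_pi_I_ne_zero h3
  rw [← h4]
  field_simp

/-- The jet of `g` at `moebius A τ` when `g (moebius A τ) = (cτ + d) f τ`. -/
theorem qJet_moebius {f g : ℂ → ℂ} (hA : A.det ≠ 0) (hUo : IsOpen U)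
    (hU : ∀ τ ∈ U, autFactor A τ ≠ 0) (hf : DifferentiableOn ℂ f U)
    (hg : ∀ τ ∈ U, g (moebius A τ) = autFactor A τ * f τ) (hτ : τ ∈ U) :
    ∃ κ : ℂ,
      qJet g (moebius A τ) 1 = (autFactor A τ ^ 3 * qJet f τ 1
        + κ * autFactor A τ ^ 2 * f τ) / A.det ∧
      qJet g (moebius A τ) 2 = (autFactor A τ ^ 5 * qJet f τ 2
        + 4 * κ * autFactor A τ ^ 4 * qJet f τ 1
        + 2 * κ ^ 2 * autFactor A τ ^ 3 * f τ) / A.det ^ 2 ∧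
      qJet g (moebius A τ) 3 = (autFactor A τ ^ 7 * qJet f τ 3
        + 9 * κ * autFactor A τ ^ 6 * qJet f τ 2
        + 18 * κ ^ 2 * autFactor A τ ^ 5 * qJet f τ 1
        + 6 * κ ^ 3 * autFactor A τ ^ 4 * f τ) / A.det ^ 3 ∧
      qJet g (moebius A τ) 4 = (autFactor A τ ^ 9 * qJet f τ 4
        + 16 * κ * autFactor A τ ^ 8 * qJet f τ 3
        + 72 * κ ^ 2 * autFactor A τ ^ 7 * qJet f τ 2
        + 96 * κ ^ 3 * autFactor A τ ^ 6 * qJet f τ 1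
        + 24 * κ ^ 4 * autFactor A τ ^ 5 * f τ) / A.det ^ 4 := by
  have hgd := differentiableOn_image_moebius hA hU hf hg
  set κ : ℂ := A 1 0 / (2 * Real.pi * Complex.I)
  have dJ : ∀ t, HasQDerivAt (autFactor A) κ t := hasQDerivAt_autFactor A
  have d : ∀ t ∈ U, ∀ n, HasQDerivAt (fun t => qJet f t n) (qJet f t (n + 1)) t :=
    fun t ht => hasQDerivAt_qJet hf hUo ht
  -- In the n-th derivative the coefficient of κʲ f⁽ⁿ⁻ʲ⁾ is j!·C(n,j)², the weight-one case of the
  -- usual quasimodular expansion.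
  have h1 : ∀ t ∈ U, qJet g (moebius A t) 1 = (autFactor A t ^ 3 * qJet f t 1
        + κ * autFactor A t ^ 2 * f t) / A.det := fun t ht => by
    rw [qJet_succ_moebius (n := 0) hA hUo hU hgd hg ht ((dJ t).mul (d t ht 0))]
    simp only [zero_add]
    ring
  have h2 : ∀ t ∈ U, qJet g (moebius A t) 2 = (autFactor A t ^ 5 * qJet f t 2
        + 4 * κ * autFactor A t ^ 4 * qJet f t 1
        + 2 * κ ^ 2 * autFactor A t ^ 3 * f t) / A.det ^ 2 := fun t ht => by
    rw [qJet_succ_moebius (n := 1) hA hUo hU hgd h1 ht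
      (((((dJ t).pow 3).mul (d t ht 1)).add
        ((((dJ t).pow 2).const_mul κ).mul (d t ht 0))).div_const _)]
    simp only [qJet_zero, zero_add]
    push_cast
    ring
  have h3 : ∀ t ∈ U, qJet g (moebius A t) 3 = (autFactor A t ^ 7 * qJet f t 3
        + 9 * κ * autFactor A t ^ 6 * qJet f t 2
        + 18 * κ ^ 2 * autFactor A t ^ 5 * qJet f t 1
        + 6 * κ ^ 3 * autFactor A t ^ 4 * f t) / A.det ^ 3 := fun t ht => by
    rw [qJet_succ_moebius (n := 2) hA hUo hU hgd h2 ht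
      ((((((dJ t).pow 5).mul (d t ht 2)).add
        ((((dJ t).pow 4).const_mul (4 * κ)).mul (d t ht 1))).add
        ((((dJ t).pow 3).const_mul (2 * κ ^ 2)).mul (d t ht 0))).div_const _)]
    simp only [qJet_zero, zero_add]
    push_cast
    ring
  have h4 : ∀ t ∈ U, qJet g (moebius A t) 4 = (autFactor A t ^ 9 * qJet f t 4
        + 16 * κ * autFactor A t ^ 8 * qJet f t 3
        + 72 * κ ^ 2 * autFactor A t ^ 7 * qJet f t 2
        + 96 * κ ^ 3 * autFactor A t ^ 6 * qJet f t 1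
        + 24 * κ ^ 4 * autFactor A t ^ 5 * f t) / A.det ^ 4 := fun t ht => by
    rw [qJet_succ_moebius (n := 3) hA hUo hU hgd h3 ht
      (((((((dJ t).pow 7).mul (d t ht 3)).add
        ((((dJ t).pow 6).const_mul (9 * κ)).mul (d t ht 2))).add
        ((((dJ t).pow 5).const_mul (18 * κ ^ 2)).mul (d t ht 1))).add
        ((((dJ t).pow 4).const_mul (6 * κ ^ 3)).mul (d t ht 0))).div_const _)]
    simp only [qJet_zero, zero_add]
    push_cast
    ring
  exact ⟨κ, h1 τ hτ, h2 τ hτ, h3 τ hτ, h4 τ hτ⟩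

theorem bracketTwo_moebius {f g : ℂ → ℂ} (hA : A.det = 1) (hUo : IsOpen U)
    (hU : ∀ τ ∈ U, autFactor A τ ≠ 0) (hf : DifferentiableOn ℂ f U)
    (hg : ∀ τ ∈ U, g (moebius A τ) = autFactor A τ * f τ) (hτ : τ ∈ U) :
    bracketTwo 1 (qJet g (moebius A τ)) = autFactor A τ ^ 6 * bracketTwo 1 (qJet f τ) := by
  obtain ⟨κ, h1, h2, -, -⟩ := qJet_moebius (by simp [hA]) hUo hU hf hg hτ
  simp only [bracketTwo, h1, h2, qJet_zero, hg τ hτ, hA]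
  push_cast
  ring

theorem bracketThree_moebius {f g : ℂ → ℂ} (hA : A.det = 1) (hUo : IsOpen U)
    (hU : ∀ τ ∈ U, autFactor A τ ≠ 0) (hf : DifferentiableOn ℂ f U)
    (hg : ∀ τ ∈ U, g (moebius A τ) = autFactor A τ * f τ) (hτ : τ ∈ U) :
    bracketThree 1 (qJet g (moebius A τ)) = autFactor A τ ^ 9 * bracketThree 1 (qJet f τ) := by
  obtain ⟨κ, h1, h2, h3, -⟩ := qJet_moebius (by simp [hA]) hUo hU hf hg hτ
  simp only [bracketThree, h1, h2, h3, qJet_zero, hg τ hτ, hA]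
  push_cast
  ring

/-- Every monomial has weight 16, counting 1 for each factor f and 2 for each derivative, and the
κ-terms cancel. The monomials carry six or four derivatives in total, hence different powers of the
determinant; determinant one makes them scale alike. -/
theorem ode3_moebius {f g : ℂ → ℂ} (hA : A.det = 1) (hUo : IsOpen U)
    (hU : ∀ τ ∈ U, autFactor A τ ≠ 0) (hf : DifferentiableOn ℂ f U)
    (hg : ∀ τ ∈ U, g (moebius A τ) = autFactor A τ * f τ) (hτ : τ ∈ U) :
    ode3 (qJet g (moebius A τ)) = autFactor A τ ^ 16 * ode3 (qJet f τ) := by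
  obtain ⟨κ, h1, h2, h3, -⟩ := qJet_moebius (by simp [hA]) hUo hU hf hg hτ
  simp only [ode3, h1, h2, h3, qJet_zero, hg τ hτ, hA]
  push_cast
  ring

/-- Every monomial has degree 4 and six derivatives in total, so the determinant factors out as a
common power and all of GL(2, ℝ) is allowed. -/
theorem ode4_moebius {f g : ℂ → ℂ} (hA : A.det ≠ 0) (hUo : IsOpen U)
    (hU : ∀ τ ∈ U, autFactor A τ ≠ 0) (hf : DifferentiableOn ℂ f U)
    (hg : ∀ τ ∈ U, g (moebius A τ) = autFactor A τ * f τ) (hτ : τ ∈ U) :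
    ode4 (qJet g (moebius A τ)) = autFactor A τ ^ 16 / A.det ^ 6 * ode4 (qJet f τ) := by
  obtain ⟨κ, h1, h2, h3, h4⟩ := qJet_moebius hA hUo hU hf hg hτ
  simp only [ode4, h1, h2, h3, h4, qJet_zero, hg τ hτ]
  ring

/-- An equation is invariant under a family of matrices closed under inversion as soon as its
solutions are mapped to solutions. -/
theorem isInvariantODE_of_forward {S : Set (Matrix (Fin 2) (Fin 2) ℝ)} {F : (ℕ → ℂ) → ℂ}
    (hS : ∀ A ∈ S, A.det ≠ 0 ∧ A⁻¹ ∈ S)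
    (hF : ∀ A ∈ S, ∀ U : Set ℂ, IsOpen U → (∀ τ ∈ U, autFactor A τ ≠ 0) → ∀ f g : ℂ → ℂ,
      (∀ τ ∈ U, g (moebius A τ) = autFactor A τ * f τ) → DifferentiableOn ℂ f U →
      (∀ τ ∈ U, F (qJet f τ) = 0) → ∀ τ ∈ U, F (qJet g (moebius A τ)) = 0) :
    IsInvariantODE 1 S F := by
  have forward : ∀ A ∈ S, ∀ U : Set ℂ, IsOpen U → (∀ τ ∈ U, autFactor A τ ≠ 0) →
      ∀ f g : ℂ → ℂ, (∀ τ ∈ U, g (moebius A τ) = autFactor A τ * f τ) →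
      IsSolutionOn F f U → IsSolutionOn F g (moebius A '' U) := by
    intro A hA U hUo hU f g hg hf
    refine ⟨differentiableOn_image_moebius (hS A hA).1 hU hf.1 hg, ?_⟩
    rintro _ ⟨τ, hτ, rfl⟩
    exact hF A hA U hUo hU f g hg hf.1 hf.2 τ hτ
  intro A hA U hUo hU f g hg
  obtain ⟨hdet, hinv⟩ := hS A hA
  simp only [zpow_one] at hg
  refine ⟨forward A hA U hUo hU f g hg, fun h => ?_⟩
  have := forward A⁻¹ hinv (moebius A '' U) (isOpen_image_moebius hdet hUo hU)
    (autFactor_inv_ne_zero hdet hU) g f ?_ h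
  · rwa [image_moebius_inv_image hdet hU] at this
  · rintro _ ⟨τ, hτ, rfl⟩
    rw [moebius_inv_moebius hdet (hU τ hτ), autFactor_inv_moebius hdet (hU τ hτ), hg τ hτ,
      inv_mul_cancel_left₀ (hU τ hτ)]

theorem isInvariantODE_ode3 : IsInvariantODE 1 {A | A.det = 1} ode3 :=
  isInvariantODE_of_forward
    (fun A (hA : A.det = 1) => ⟨by simp [hA], by simp [Matrix.det_nonsing_inv, hA]⟩)
    fun A hA U hUo hU f g hg hf h τ hτ => by rw [ode3_moebius hA hUo hU hf hg hτ, h τ hτ, mul_zero]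

theorem isInvariantODE_ode4 : IsInvariantODE 1 {A | A.det ≠ 0} ode4 :=
  isInvariantODE_of_forward (fun A hA => ⟨hA, det_inv_ne_zero hA⟩)
    fun A hA U hUo hU f g hg hf h τ hτ => by rw [ode4_moebius hA hUo hU hf hg hτ, h τ hτ, mul_zero]

end Moebius

/-! ### The nome -/

section Nome

/-- The nome `q = exp (2πiτ)`. -/
noncomputable def nome (τ : ℂ) : ℂ := Complex.exp (2 * Real.pi * Complex.I * τ)

theorem norm_nome (τ : ℂ) : ‖nome τ‖ = Real.exp (-2 * Real.pi * τ.im) := by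
  rw [nome, Complex.norm_exp]
  congr 1
  simp

theorem nome_ne_zero (τ : ℂ) : nome τ ≠ 0 := Complex.exp_ne_zero _

theorem nome_mem_ball {τ : ℂ} (h : 0 < τ.im) : nome τ ∈ Metric.ball (0 : ℂ) 1 := by
  rw [mem_ball_zero_iff, norm_nome, Real.exp_lt_one_iff]
  nlinarith [Real.pi_pos]

theorem nome_add_intCast (τ : ℂ) (n : ℤ) : nome (τ + n) = nome τ := by
  rw [nome, nome, Complex.exp_eq_exp_iff_exists_int]
  exact ⟨n, by ring⟩

theorem exists_nome_eq {z : ℂ} (hz : z ∈ Metric.ball (0 : ℂ) 1) (h0 : z ≠ 0) :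
    ∃ τ : ℂ, 0 < τ.im ∧ nome τ = z := by
  refine ⟨Complex.log z / (2 * Real.pi * Complex.I), ?_, ?_⟩
  · have h : nome (Complex.log z / (2 * Real.pi * Complex.I)) = z := by
      rw [nome, mul_div_cancel₀ _ Complex.two_pi_I_ne_zero, Complex.exp_log h0]
    rw [mem_ball_zero_iff, ← h, norm_nome, Real.exp_lt_one_iff] at hz
    nlinarith [Real.pi_pos]
  · rw [nome, mul_div_cancel₀ _ Complex.two_pi_I_ne_zero, Complex.exp_log h0]

theorem hasDerivAt_nome (τ : ℂ) :
    HasDerivAt nome (2 * Real.pi * Complex.I * nome τ) τ := by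
  have h := (((hasDerivAt_id τ).const_mul (2 * Real.pi * Complex.I)).cexp)
  exact h.congr_deriv (by simp only [id, nome]; ring)

theorem hasQDerivAt_comp_nome {G : ℂ → ℂ} {τ a : ℂ} (h : HasDerivAt G a (nome τ)) :
    HasQDerivAt (fun t => G (nome t)) (nome τ * a) τ :=
  (HasDerivAt.comp τ h (hasDerivAt_nome τ)).congr_deriv (by ring)

theorem fricke_im (τ : ℂ) : (-1 / (3 * τ)).im = τ.im / (3 * Complex.normSq τ) := by
  rw [neg_div, one_div, Complex.neg_im, Complex.inv_im]
  simp [Complex.normSq_mul]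
  field_simp

theorem fricke_im_pos {τ : ℂ} (h : 0 < τ.im) : 0 < (-1 / (3 * τ)).im := by
  have h3 : (0 : ℝ) < Complex.normSq τ := Complex.normSq_pos.2 fun h0 => by simp [h0] at h
  rw [fricke_im]
  positivity

end Nome

/-! ### A maximum principle for the Fricke involution -/

section MaximumPrinciple

/-- Translations and `τ ↦ -1 / (3τ)` move every point of the upper half-plane to height at least
`1 / 4`; stated for functions of the nome with invariant norm. -/
theorem exists_norm_nome_eq {H : ℂ → ℂ}
    (hW : ∀ τ : ℂ, 0 < τ.im → ‖H (nome (-1 / (3 * τ)))‖ = ‖H (nome τ)‖) (n : ℕ) :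
    ∀ τ : ℂ, 0 < τ.im → 1 / 4 * (15 / 16 : ℝ) ^ n ≤ τ.im →
      ∃ τ' : ℂ, 1 / 4 ≤ τ'.im ∧ ‖H (nome τ')‖ = ‖H (nome τ)‖ := by
  induction n with
  | zero => exact fun τ _ h => ⟨τ, by simpa using h, rfl⟩
  | succ n ih =>
    intro τ hτ h
    by_cases h4 : 1 / 4 ≤ τ.im
    · exact ⟨τ, h4, rfl⟩
    set t : ℂ := τ + ((-round τ.re : ℤ) : ℂ) with ht
    have hti : t.im = τ.im := by simp [ht]
    have htr : |t.re| ≤ 1 / 2 := by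
      have := abs_sub_round τ.re
      simpa [ht, sub_eq_add_neg] using this
    have hn : nome t = nome τ := nome_add_intCast τ _
    have ht0 : 0 < t.im := hti ▸ hτ
    have hs : 0 < Complex.normSq t := Complex.normSq_pos.2 fun h0 => by simp [h0] at ht0
    -- With |Re t| ≤ 1/2 and Im t < 1/4, 3|t|² ≤ 3(1/4 + 1/16) = 15/16, so the involution raises the
    -- height by a factor of at least 16/15.
    have hs2 : 3 * Complex.normSq t ≤ 15 / 16 := by
      rw [Complex.normSq_apply]
      have := abs_le.1 htr
      nlinarith
    have him : t.im * (16 / 15) ≤ (-1 / (3 * t)).im := by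
      rw [fricke_im, le_div_iff₀ (by positivity)]
      nlinarith
    obtain ⟨τ', h1, h2⟩ := ih (-1 / (3 * t)) (fricke_im_pos ht0) (by
      rw [pow_succ] at h
      rw [hti] at him
      linarith)
    exact ⟨τ', h1, by rw [h2, hW t ht0, hn]⟩

/-- A holomorphic function of the nome whose norm is invariant under `τ ↦ -1 / (3τ)` is
constant. -/
theorem eq_of_norm_fricke_invariant {H : ℂ → ℂ} (hH : DifferentiableOn ℂ H (Metric.ball 0 1))
    (hW : ∀ τ : ℂ, 0 < τ.im → ‖H (nome (-1 / (3 * τ)))‖ = ‖H (nome τ)‖) :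
    ∀ z ∈ Metric.ball (0 : ℂ) 1, H z = H 0 := by
  -- The closed disc of radius r consists of q = 0 and the nomes of height at least 1/4. By
  -- compactness the norm has a maximum there, and by invariance it is a maximum over the whole unit
  -- disc, at an interior point.
  set r : ℝ := Real.exp (-2 * Real.pi * (1 / 4))
  have hr : r < 1 := by
    rw [Real.exp_lt_one_iff]
    nlinarith [Real.pi_pos]
  have hsub : Metric.closedBall (0 : ℂ) r ⊆ Metric.ball 0 1 := Metric.closedBall_subset_ball hr
  have h0 : (0 : ℂ) ∈ Metric.closedBall (0 : ℂ) r :=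
    Metric.mem_closedBall_self (Real.exp_pos _).le
  obtain ⟨z₀, hz₀, hmax⟩ := (isCompact_closedBall (0 : ℂ) r).exists_isMaxOn ⟨0, h0⟩
    (hH.continuousOn.mono hsub).norm
  have hM : IsMaxOn (norm ∘ H) (Metric.ball 0 1) z₀ := by
    intro z hz
    by_cases hz0 : z = 0
    · exact hz0 ▸ hmax h0
    obtain ⟨τ, hτ, rfl⟩ := exists_nome_eq hz hz0
    obtain ⟨n, hn⟩ := exists_pow_lt_of_lt_one hτ (show (15 / 16 : ℝ) < 1 by norm_num)
    have hp : (0 : ℝ) < (15 / 16) ^ n := by positivity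
    obtain ⟨τ', h1, h2⟩ := exists_norm_nome_eq hW n τ hτ (by linarith)
    have h3 : nome τ' ∈ Metric.closedBall (0 : ℂ) r := by
      rw [mem_closedBall_zero_iff, norm_nome, Real.exp_le_exp]
      nlinarith [Real.pi_pos]
    have h4 := hmax h3
    simp only [mem_ofPred_eq, Function.comp_apply] at h4 ⊢
    rwa [h2] at h4
  have := Complex.eqOn_of_isPreconnected_of_isMaxOn_norm (convex_ball (0 : ℂ) 1).isPreconnected
    Metric.isOpen_ball hH (hsub hz₀) hM
  exact fun z hz => (this hz).trans (this (hsub h0)).symm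

end MaximumPrinciple

/-! ### The eta product η(τ)²⁴η(3τ)²⁴ -/

section Discriminant

/-- The discriminant divided by the nome, as a function of the nome. -/
noncomputable def eulerProd (q : ℂ) : ℂ := ∏' n : ℕ, (1 - q ^ (n + 1)) ^ 24

theorem differentiableOn_eulerProd : DifferentiableOn ℂ eulerProd (Metric.ball 0 1) :=
  ModularForm.differentiableOn_tprod_one_sub_pow_pow 24

theorem eulerProd_zero : eulerProd 0 = 1 := by simp [eulerProd]

theorem eta_pow_eq {τ : ℂ} (hτ : 0 < τ.im) :
    ModularForm.eta τ ^ 24 = nome τ * eulerProd (nome τ) := by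
  simpa [ModularForm.discriminant, eulerProd, nome, Function.Periodic.qParam,
    ModularForm.eta_q] using ModularForm.discriminant_eq_q_prod ⟨τ, hτ⟩

theorem eulerProd_ne_zero {z : ℂ} (hz : z ∈ Metric.ball (0 : ℂ) 1) : eulerProd z ≠ 0 := by
  by_cases h0 : z = 0
  · rw [h0, eulerProd_zero]; exact one_ne_zero
  obtain ⟨τ, hτ, rfl⟩ := exists_nome_eq hz h0
  intro h
  have := eta_pow_eq hτ
  rw [h, mul_zero] at this
  exact ModularForm.eta_ne_zero hτ (pow_eq_zero_iff (by norm_num) |>.1 this)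

theorem eta_pow_neg_one_div {τ : ℂ} (hτ : 0 < τ.im) :
    ModularForm.eta (-1 / τ) ^ 24 = τ ^ 12 * ModularForm.eta τ ^ 24 := by
  have h := ModularForm.eta_comp_eq_csqrt_I_inv hτ
  simp only [Function.comp_apply, Pi.smul_apply, Pi.mul_apply, smul_eq_mul] at h
  have hs : ∀ z : ℂ, Complex.sqrt z ^ 24 = z ^ 12 := fun z => by
    rw [Complex.sqrt, ← Complex.cpow_nat_mul, ← Complex.cpow_natCast z 12]
    norm_num
  rw [h, mul_pow, mul_pow, inv_pow, hs, hs,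
    show Complex.I ^ 12 = (Complex.I ^ 4) ^ 3 by ring, Complex.I_pow_four]
  ring

/-- `η(τ)^24 η(3τ)^24` in terms of the nome. -/
theorem eta_pow_mul_eta_pow {τ : ℂ} (hτ : 0 < τ.im) :
    ModularForm.eta τ ^ 24 * ModularForm.eta (3 * τ) ^ 24 =
      nome τ ^ 4 * (eulerProd (nome τ) * eulerProd (nome τ ^ 3)) := by
  have h3 : nome (3 * τ) = nome τ ^ 3 := by
    rw [nome, nome, ← Complex.exp_nat_mul]
    congr 1
    push_cast
    ring
  rw [eta_pow_eq hτ, eta_pow_eq (by simpa using hτ), h3]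
  ring

theorem eta_pow_mul_eta_pow_fricke {τ : ℂ} (hτ : 0 < τ.im) :
    ModularForm.eta (-1 / (3 * τ)) ^ 24 * ModularForm.eta (3 * (-1 / (3 * τ))) ^ 24 =
      3 ^ 12 * τ ^ 24 * (ModularForm.eta τ ^ 24 * ModularForm.eta (3 * τ) ^ 24) := by
  have hne : τ ≠ 0 := fun h0 => by simp [h0] at hτ
  rw [show 3 * (-1 / (3 * τ)) = -1 / τ by field_simp, eta_pow_neg_one_div hτ,
    eta_pow_neg_one_div (show 0 < (3 * τ).im by simpa using hτ)]
  ring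

end Discriminant

/-! ### Convergence and q-expansion of the series -/

section Series

/-- The norm `α² - αβ + β²` as a natural number. -/
def eisNorm (p : ℤ × ℤ) : ℕ := (p.1 ^ 2 - p.1 * p.2 + p.2 ^ 2).toNat

theorem eisNorm_cast (p : ℤ × ℤ) : (eisNorm p : ℤ) = p.1 ^ 2 - p.1 * p.2 + p.2 ^ 2 :=
  Int.toNat_of_nonneg (by nlinarith [sq_nonneg (p.1 - p.2), sq_nonneg (p.1 + p.2)])

/-- Twice the norm is α² + β² + (α - β)². The linear bound reduces convergence to a product of two
geometric series in √r. -/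
theorem natAbs_add_natAbs_le (p : ℤ × ℤ) : p.1.natAbs + p.2.natAbs ≤ 2 * eisNorm p := by
  zify
  rw [eisNorm_cast]
  have h1 : |p.1| ≤ p.1 ^ 2 := by simpa using Int.natAbs_le_self_sq p.1
  have h2 : |p.2| ≤ p.2 ^ 2 := by simpa using Int.natAbs_le_self_sq p.2
  nlinarith [sq_nonneg (p.1 - p.2)]

theorem summable_pow_natAbs {s : ℝ} (h0 : 0 ≤ s) (h1 : s < 1) :
    Summable fun n : ℤ => s ^ n.natAbs := by
  have := summable_geometric_of_lt_one h0 h1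
  exact Summable.of_nat_of_neg (by simpa using this) (by simpa using this)

theorem summable_pow_eisNorm {r : ℝ} (h0 : 0 ≤ r) (h1 : r < 1) :
    Summable fun p => r ^ eisNorm p := by
  have hs1 : √r < 1 := by rw [Real.sqrt_lt' one_pos]; simpa using h1
  have hs := summable_pow_natAbs (Real.sqrt_nonneg r) hs1
  refine (hs.mul_of_nonneg hs (fun _ => by positivity) (fun _ => by positivity)).of_nonneg_of_le
    (fun _ => by positivity) fun p => ?_
  rw [← pow_add]
  calc r ^ eisNorm p = √r ^ (2 * eisNorm p) := by rw [pow_mul, Real.sq_sqrt h0]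
    _ ≤ _ := pow_le_pow_of_le_one (Real.sqrt_nonneg r) hs1.le (natAbs_add_natAbs_le p)

theorem exp_eq_nome_pow (τ : ℂ) (p : ℤ × ℤ) :
    Complex.exp (2 * Real.pi * Complex.I * τ * ((p.1 ^ 2 - p.1 * p.2 + p.2 ^ 2 : ℤ) : ℂ)) =
      nome τ ^ eisNorm p := by
  rw [nome, ← Complex.exp_nat_mul, ← eisNorm_cast]
  congr 1
  push_cast
  ring

theorem summable_E13_nome {q : ℂ} (hq : q ∈ Metric.ball (0 : ℂ) 1) :
    Summable fun p => q ^ eisNorm p := by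
  refine Summable.of_norm ?_
  simpa only [norm_pow] using summable_pow_eisNorm (norm_nonneg q) (by simpa using hq)

theorem summable_E13 {τ : ℂ} (hτ : 0 < τ.im) : Summable fun p : ℤ × ℤ =>
    Complex.exp (2 * Real.pi * Complex.I * τ * ((p.1 ^ 2 - p.1 * p.2 + p.2 ^ 2 : ℤ) : ℂ)) := by
  simp only [exp_eq_nome_pow]
  exact summable_E13_nome (nome_mem_ball hτ)

theorem E13_eq_tsum_nome (τ : ℂ) : E13 τ = ∑' p, nome τ ^ eisNorm p := by
  simp only [E13, exp_eq_nome_pow]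

/-- The six units of the Eisenstein integers. -/
def eisUnits : Finset (ℤ × ℤ) := {(1, 0), (-1, 0), (0, 1), (0, -1), (1, 1), (-1, -1)}

/-- The form does not represent 2, which is why the expansion 1 + 6q has no q² term. -/
theorem eisNorm_cases (p : ℤ × ℤ) :
    p = 0 ∨ p ∈ eisUnits ∧ eisNorm p = 1 ∨ p ≠ 0 ∧ p ∉ eisUnits ∧ 3 ≤ eisNorm p := by
  by_cases h : 3 ≤ eisNorm p
  · refine Or.inr (Or.inr ⟨?_, ?_, h⟩)
    · rintro rfl; simp [eisNorm] at h
    · intro hp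
      simp only [eisUnits, Finset.mem_insert, Finset.mem_singleton] at hp
      rcases hp with rfl | rfl | rfl | rfl | rfl | rfl <;> simp [eisNorm] at h
  · have h2 : p.1 ^ 2 - p.1 * p.2 + p.2 ^ 2 ≤ 2 := by rw [← eisNorm_cast]; omega
    obtain ⟨a, b⟩ := p
    simp only at h2
    have ha1 : a ≤ 1 := by nlinarith [sq_nonneg (a - 2 * b)]
    have ha2 : -1 ≤ a := by nlinarith [sq_nonneg (a - 2 * b)]
    have hb1 : b ≤ 1 := by nlinarith [sq_nonneg (b - 2 * a)]
    have hb2 : -1 ≤ b := by nlinarith [sq_nonneg (b - 2 * a)]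
    interval_cases a <;> interval_cases b <;> simp [eisUnits, eisNorm] at h2 ⊢

/-- The tail of the series of `E13`, divided by `q ^ 3`. -/
noncomputable def E13Tail (q : ℂ) : ℂ :=
  ∑' p, if 3 ≤ eisNorm p then q ^ (eisNorm p - 3) else 0

theorem differentiableOn_E13Tail : DifferentiableOn ℂ E13Tail (Metric.ball 0 1) := by
  intro z hz
  obtain ⟨r, hzr, hr1⟩ := exists_between (mem_ball_zero_iff.1 hz)
  have hr0 : 0 < r := (norm_nonneg z).trans_lt hzr
  have hsum : Summable fun p => (r ^ 3)⁻¹ * r ^ eisNorm p :=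
    (summable_pow_eisNorm hr0.le hr1).mul_left _
  have hd : DifferentiableOn ℂ E13Tail (Metric.ball 0 r) := by
    refine Complex.differentiableOn_tsum_of_summable_norm hsum (fun p => ?_) Metric.isOpen_ball
      fun p w hw => ?_
    · split_ifs <;> fun_prop
    · rw [mem_ball_zero_iff] at hw
      split_ifs with h
      · rw [norm_pow, mul_comm, ← pow_sub₀ r hr0.ne' h]
        gcongr
      · simp only [norm_zero]; positivity
  exact (hd.differentiableAt (Metric.isOpen_ball.mem_nhds
    (mem_ball_zero_iff.2 hzr))).differentiableWithinAt

theorem tsum_pow_eisNorm {q : ℂ} (hq : q ∈ Metric.ball (0 : ℂ) 1) :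
    ∑' p, q ^ eisNorm p = 1 + 6 * q + q ^ 3 * E13Tail q := by
  have h0 : HasSum (fun p : ℤ × ℤ => if p = 0 then (1 : ℂ) else 0) 1 := hasSum_ite_eq 0 1
  have h1 : HasSum (fun p : ℤ × ℤ => if p ∈ eisUnits then q else 0) (6 * q) := by
    have : HasSum (fun p : ℤ × ℤ => if p ∈ eisUnits then q else 0)
        (∑ p ∈ eisUnits, if p ∈ eisUnits then q else 0) :=
      hasSum_sum_of_ne_finset_zero fun p hp => if_neg hp
    rwa [Finset.sum_congr rfl fun p hp => if_pos hp, Finset.sum_const,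
      show eisUnits.card = 6 from rfl, nsmul_eq_mul] at this
  have hsplit : ∀ p, q ^ eisNorm p = ((if p = 0 then (1 : ℂ) else 0)
      + if p ∈ eisUnits then q else 0)
      + q ^ 3 * if 3 ≤ eisNorm p then q ^ (eisNorm p - 3) else 0 := by
    intro p
    rcases eisNorm_cases p with rfl | ⟨hp, h⟩ | ⟨hp, hp', h⟩
    · simp [eisNorm, show (0 : ℤ × ℤ) ∉ eisUnits by decide]
    · have hp0 : p ≠ 0 := by rintro rfl; simp [eisNorm] at h
      simp [hp, h, hp0]
    · simp only [hp, hp', h, if_true, if_false, ← pow_add]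
      simp [Nat.add_sub_cancel' h]
  have h2 : Summable fun p => q ^ 3 * if 3 ≤ eisNorm p then q ^ (eisNorm p - 3) else 0 := by
    refine ((summable_E13_nome hq).sub (h0.summable.add h1.summable)).congr fun p => ?_
    rw [hsplit p]; ring
  rw [tsum_congr hsplit, (h0.summable.add h1.summable).tsum_add h2, (h0.add h1).tsum_eq,
    tsum_mul_left, E13Tail]

theorem E13_eq {τ : ℂ} (hτ : 0 < τ.im) :
    E13 τ = 1 + 6 * nome τ + nome τ ^ 3 * E13Tail (nome τ) := by
  rw [E13_eq_tsum_nome, tsum_pow_eisNorm (nome_mem_ball hτ)]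

end Series

/-! ### The Fricke transformation of the series -/

section Fricke

/-- Scaling by a positive real does not change the argument, so both principal roots use the same
branch of log w. -/
theorem cpow_half_mul_cpow_half {w : ℂ} (hw : w ≠ 0) :
    (2 * w) ^ (1 / 2 : ℂ) * (3 / 2 * w) ^ (1 / 2 : ℂ) = (√3 : ℝ) * w := by
  have h2 : Complex.log (2 * w) = Real.log 2 + Complex.log w := by
    simpa using Complex.log_ofReal_mul (show (0 : ℝ) < 2 by norm_num) hw
  have h3 : Complex.log (3 / 2 * w) = Real.log (3 / 2) + Complex.log w := by
    simpa using Complex.log_ofReal_mul (show (0 : ℝ) < 3 / 2 by norm_num) hw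
  have h4 : Real.log 2 + Real.log (3 / 2) = Real.log 3 := by
    rw [← Real.log_mul (by norm_num) (by norm_num)]; norm_num
  have h5 : √3 = Real.exp (Real.log 3 / 2) := by
    rw [Real.exp_half, Real.exp_log (by norm_num)]
  rw [Complex.cpow_def_of_ne_zero (by simpa using hw),
    Complex.cpow_def_of_ne_zero (by simpa using hw), ← Complex.exp_add, h2, h3, h5, Complex.ofReal_exp, ← h4]
  conv_rhs => rw [← Complex.exp_log hw, ← Complex.exp_add]
  congr 1
  push_cast
  ring

/-- Inverting the theta series in one lattice variable turns the sum into the mixed double sum of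
`G`. Exchanging the summations and inverting in the other variable gives the same quadratic form at
-1/(3τ); the two square-root factors combine to √3·(-iτ). -/
theorem E13_fricke {τ : ℂ} (hτ : 0 < τ.im) :
    E13 (-1 / (3 * τ)) = (√3 : ℝ) * τ * (-Complex.I * E13 τ) := by
  have hne : τ ≠ 0 := fun h0 => by simp [h0] at hτ
  set G : ℤ → ℤ → ℂ := fun b m => Complex.exp (Real.pi * Complex.I * (3 / 2 * τ) * b ^ 2
    - Real.pi * Complex.I * m * b - Real.pi * Complex.I * m ^ 2 / (2 * τ)) with hG
  have hi1 : 0 < (3 / 2 * τ).im := by simpa using hτ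
  have hi2 : 0 < (-1 / (2 * τ)).im := by
    have := fricke_im_pos (τ := 2 / 3 * τ) (by simpa using hτ)
    rwa [show 3 * (2 / 3 * τ) = 2 * τ by ring] at this
  -- The cross term exp(-πimb) has modulus one, so the norm of `G` is a product of norms of two
  -- theta terms.
  have hsum : Summable (Function.uncurry G) := by
    have s1 := ((summable_jacobiTheta₂_term_iff 0 _).2 hi1).norm
    have s2 := ((summable_jacobiTheta₂_term_iff 0 _).2 hi2).norm
    refine Summable.of_norm ((s1.mul_of_nonneg s2 (fun _ => norm_nonneg _)
      fun _ => norm_nonneg _).congr fun p => ?_)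
    obtain ⟨b, m⟩ := p
    simp only [Function.uncurry, hG, jacobiTheta₂_term]
    rw [← norm_mul, ← Complex.exp_add, Complex.norm_exp, Complex.norm_exp]
    congr 1
    rw [show Real.pi * Complex.I * (3 / 2 * τ) * b ^ 2 - Real.pi * Complex.I * m * b
      - Real.pi * Complex.I * m ^ 2 / (2 * τ) = (2 * Real.pi * Complex.I * b * 0
      + Real.pi * Complex.I * b ^ 2 * (3 / 2 * τ) + (2 * Real.pi * Complex.I * m * 0
      + Real.pi * Complex.I * m ^ 2 * (-1 / (2 * τ)))) - ((Real.pi * m * b : ℝ) : ℂ) * Complex.I by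
        push_cast; field_simp; ring, Complex.sub_re, Complex.re_ofReal_mul, Complex.I_re]
    ring
  have step1 : E13 τ = 1 / (-Complex.I * (2 * τ)) ^ (1 / 2 : ℂ) * ∑' b, ∑' m, G b m := by
    rw [E13, (summable_E13 hτ).tsum_prod, ← tsum_mul_left]
    refine tsum_congr fun b => ?_
    have e1 : ∑' a : ℤ, Complex.exp (2 * Real.pi * Complex.I * τ *
        (((b, a).1 ^ 2 - (b, a).1 * (b, a).2 + (b, a).2 ^ 2 : ℤ) : ℂ)) =
        Complex.exp (2 * Real.pi * Complex.I * τ * b ^ 2) * jacobiTheta₂ (-b * τ) (2 * τ) := by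
      rw [jacobiTheta₂, ← tsum_mul_left]
      refine tsum_congr fun a => ?_
      rw [jacobiTheta₂_term, ← Complex.exp_add]
      congr 1
      push_cast
      ring
    rw [e1, jacobiTheta₂_functional_equation, jacobiTheta₂, ← tsum_mul_left, ← tsum_mul_left,
      ← tsum_mul_left]
    refine tsum_congr fun m => ?_
    rw [jacobiTheta₂_term, hG, show ∀ a c b d : ℂ, a * (c * b * d) = c * (a * b * d) from
      fun _ _ _ _ => by ring, ← Complex.exp_add, ← Complex.exp_add]
    congr 2
    field_simp
    ring
  have step2 : ∑' m, ∑' b, G b m =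
      1 / (-Complex.I * (3 / 2 * τ)) ^ (1 / 2 : ℂ) * E13 (-1 / (3 * τ)) := by
    rw [E13, (summable_E13 (fricke_im_pos hτ)).tsum_prod, ← tsum_mul_left]
    refine tsum_congr fun m => ?_
    have e1 : ∑' b, G b m = Complex.exp (-Real.pi * Complex.I * m ^ 2 / (2 * τ)) *
        jacobiTheta₂ (-m / 2) (3 / 2 * τ) := by
      rw [jacobiTheta₂, ← tsum_mul_left]
      refine tsum_congr fun b => ?_
      rw [jacobiTheta₂_term, ← Complex.exp_add]
      simp only [hG]
      congr 1
      ring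
    -- Reversing the sign of the dual variable gives the cross term of the quadratic form its minus
    -- sign.
    rw [e1, jacobiTheta₂_functional_equation, jacobiTheta₂, ← (Equiv.neg ℤ).tsum_eq,
      ← tsum_mul_left, ← tsum_mul_left, ← tsum_mul_left]
    refine tsum_congr fun n => ?_
    rw [jacobiTheta₂_term, show ∀ a c b d : ℂ, a * (c * b * d) = c * (a * b * d) from
      fun _ _ _ _ => by ring, ← Complex.exp_add, ← Complex.exp_add]
    simp only [Equiv.neg_apply]
    congr 2
    push_cast
    field_simp
    ring
  rw [← hsum.tsum_comm, step2, ← mul_assoc, one_div_mul_one_div,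
    show -Complex.I * (2 * τ) = 2 * (-Complex.I * τ) by ring,
    show -Complex.I * (3 / 2 * τ) = 3 / 2 * (-Complex.I * τ) by ring,
    cpow_half_mul_cpow_half (by simpa using hne)] at step1
  have h3 : ((√3 : ℝ) : ℂ) ≠ 0 := by simp
  rw [step1]
  field_simp
  

end Fricke

/-! ### Recovering M and N from the covariants -/

section HuberConstruction

variable {f : ℂ → ℂ} {U : Set ℂ}

/-- A function with `B₃² + 18 B₂³ = f⁶ B₂²`, `B₂` being nowhere zero, solves Huber's system. -/
theorem exists_isHuberSolutionOn (hU : IsOpen U) (hc : IsPreconnected U)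
    (hf : DifferentiableOn ℂ f U) (h2 : ∀ τ ∈ U, bracketTwo 1 (qJet f τ) ≠ 0)
    (rel : ∀ τ ∈ U, bracketThree 1 (qJet f τ) ^ 2 + 18 * bracketTwo 1 (qJet f τ) ^ 3
      - f τ ^ 6 * bracketTwo 1 (qJet f τ) ^ 2 = 0)
    (hf0 : ∃ τ ∈ U, f τ ≠ 0) (h3 : ∃ τ ∈ U, bracketThree 1 (qJet f τ) ≠ 0) :
    ∃ M N : ℂ → ℂ, IsHuberSolutionOn f M N U := by
  obtain ⟨τ₀, hτ₀, hf₀⟩ := hf0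
  obtain ⟨τ₁, hτ₁, h₁⟩ := h3
  set H : ℂ → ℂ := fun t => bracketThree 1 (qJet f t) / bracketTwo 1 (qJet f t) with hH
  -- Huber's system forces B₂ = (2/9)N(f³ - N) and (f³ - N)' = M(f³ - N). Thus N = X and f³ - N = Y
  -- have sum f³ and product 9B₂/2; their difference is B₃/B₂.
  set X : ℂ → ℂ := fun t => (f t ^ 3 + H t) / 2 with hX
  set Y : ℂ → ℂ := fun t => (f t ^ 3 - H t) / 2 with hY
  have dH : DifferentiableOn ℂ H U :=
    (differentiableOn_bracketThree hf hU).div (differentiableOn_bracketTwo hf hU) h2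
  have dX : DifferentiableOn ℂ X U := ((hf.pow 3).add dH).div_const 2
  have dY : DifferentiableOn ℂ Y U := ((hf.pow 3).sub dH).div_const 2
  have hXY : ∀ τ ∈ U, X τ * Y τ = 9 / 2 * bracketTwo 1 (qJet f τ) := fun τ hτ => by
    have r := rel τ hτ
    have h := h2 τ hτ
    simp only [hX, hY, hH]
    field_simp
    linear_combination -r
  have hX0 : ∀ τ ∈ U, X τ ≠ 0 := fun τ hτ h0 => h2 τ hτ (by
    have := hXY τ hτ
    rw [h0, zero_mul] at this
    linear_combination -(2 / 9) * this)
  have hY0 : ∀ τ ∈ U, Y τ ≠ 0 := fun τ hτ h0 => h2 τ hτ (by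
    have := hXY τ hτ
    rw [h0, mul_zero] at this
    linear_combination -(2 / 9) * this)
  have qX : ∀ τ ∈ U, HasQDerivAt X (qDeriv X τ) τ := fun τ hτ =>
    (dX.differentiableAt (hU.mem_nhds hτ)).hasQDerivAt
  have qY : ∀ τ ∈ U, HasQDerivAt Y (qDeriv Y τ) τ := fun τ hτ =>
    (dY.differentiableAt (hU.mem_nhds hτ)).hasQDerivAt
  have sum_eq : ∀ τ, X τ + Y τ = f τ ^ 3 := fun τ => by simp only [hX, hY]; ring
  have dsum : ∀ τ ∈ U, qDeriv X τ + qDeriv Y τ = 3 * f τ ^ 2 * qJet f τ 1 := fun τ hτ =>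
    (((qX τ hτ).add (qY τ hτ)).congr_of_eqOn hU hτ fun t _ => (sum_eq t).symm).unique
      (((hasQDerivAt_qJet hf hU hτ 0).pow 3).congr_deriv (by simp))
  have dprod : ∀ τ ∈ U, f τ * (qDeriv X τ * Y τ + X τ * qDeriv Y τ) =
      (6 * qJet f τ 1 + X τ - Y τ) * (X τ * Y τ) := fun τ hτ => by
    have e := (((qX τ hτ).mul (qY τ hτ)).congr_of_eqOn hU hτ
      fun t ht => (hXY t ht).symm).unique ((hasQDerivAt_bracketTwo hf hU hτ).const_mul (9 / 2))
    have hHB : (X τ - Y τ) * bracketTwo 1 (qJet f τ) = bracketThree 1 (qJet f τ) := by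
      have h := h2 τ hτ
      simp only [hX, hY, hH]
      field_simp
      ring
    rw [e, hXY τ hτ]
    simp only [qJet_zero, bracketTwo, bracketThree] at hHB ⊢
    linear_combination -(9 / 2) * hHB
  -- This is Y'/Y - X'/X = f² with denominators cleared. It follows from the derivatives of X + Y
  -- and XY after multiplication by X - Y = `H`, which is not identically zero.
  have hZ : ∀ τ ∈ U, X τ * qDeriv Y τ - Y τ * qDeriv X τ - f τ ^ 2 * (X τ * Y τ) = 0 := by
    have dZ : DifferentiableOn ℂ
        (fun τ => X τ * qDeriv Y τ - Y τ * qDeriv X τ - f τ ^ 2 * (X τ * Y τ)) U := by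
      have := dX.qDeriv hU
      have := dY.qDeriv hU
      fun_prop
    refine (eqOn_zero_or_eqOn_zero_of_mul hU hc dH dZ fun τ hτ => ?_).resolve_left
      fun h => div_ne_zero h₁ (h2 τ₁ hτ₁) (h τ₁ hτ₁)
    have hHX : H τ = X τ - Y τ := by simp only [hX, hY]; ring
    rw [hHX]
    linear_combination f τ ^ 2 * dprod τ hτ - 2 * X τ * Y τ * dsum τ hτ
      + (qDeriv X τ * Y τ + X τ * qDeriv Y τ) * sum_eq τ
  set M : ℂ → ℂ := fun t => qDeriv Y t / Y t with hM
  have dM : DifferentiableOn ℂ M U := (dY.qDeriv hU).div dY hY0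
  have hMY : ∀ τ ∈ U, qDeriv Y τ = M τ * Y τ := fun τ hτ => (div_mul_cancel₀ _ (hY0 τ hτ)).symm
  have hN' : ∀ τ ∈ U, qDeriv X τ = (M τ - f τ ^ 2) * X τ := fun τ hτ => by
    refine mul_left_cancel₀ (hY0 τ hτ) ?_
    linear_combination -hZ τ hτ + X τ * hMY τ hτ
  have hf' : ∀ τ ∈ U, f τ * M τ = 3 * qJet f τ 1 + X τ := fun τ hτ => by
    have e := dprod τ hτ
    rw [hMY τ hτ, hN' τ hτ] at e
    refine mul_left_cancel₀ (mul_ne_zero (hX0 τ hτ) (hY0 τ hτ)) ?_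
    linear_combination (1 / 2) * e - X τ * Y τ / 2 * sum_eq τ
  have qM : ∀ τ ∈ U, HasQDerivAt M (qDeriv M τ) τ := fun τ hτ =>
    (dM.differentiableAt (hU.mem_nhds hτ)).hasQDerivAt
  -- Differentiate fM = 3f' + X, multiply by f, and eliminate f'' through XY = 9B₂/2; a factor f²
  -- then cancels.
  have hM' : ∀ τ ∈ U, qDeriv M τ - (M τ ^ 2 - X τ * f τ) / 3 = 0 := by
    have dW : DifferentiableOn ℂ (fun τ => qDeriv M τ - (M τ ^ 2 - X τ * f τ) / 3) U := by
      have := dM.qDeriv hU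
      fun_prop
    refine (eqOn_zero_or_eqOn_zero_of_mul hU hc (hf.pow 2) dW fun τ hτ => ?_).resolve_left
      fun h => pow_ne_zero 2 hf₀ (h τ₀ hτ₀)
    have e := (((hasQDerivAt_qJet hf hU hτ 0).mul (qM τ hτ)).congr_of_eqOn hU hτ
      fun t ht => (hf' t ht).symm).unique
        (((hasQDerivAt_qJet hf hU hτ 1).const_mul 3).add (qX τ hτ))
    have e1 := hf' τ hτ
    have e2 := hXY τ hτ
    have e3 := sum_eq τ
    rw [hN' τ hτ] at e
    simp only [bracketTwo, qJet_zero, zero_add, Pi.pow_apply] at e e2 ⊢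
    have hY' : Y τ = f τ ^ 3 - X τ := by linear_combination e3
    have hq : qJet f τ 1 = (f τ * M τ - X τ) / 3 := by linear_combination -e1 / 3
    rw [hY', hq] at e2
    rw [hq] at e
    linear_combination f τ * e - (2 / 3) * e2
  refine ⟨M, X, hf, dM, dX, fun τ hτ => ⟨?_, ?_, hN' τ hτ⟩⟩
  · rw [← qJet_one]
    linear_combination -hf' τ hτ / 3
  · linear_combination hM' τ hτ

end HuberConstruction

/-! ### Leading q-expansions of the covariants -/

section NomeExpansions

/-- The operator q d/dq kills the constant term, fixes the linear one and keeps a remainder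
divisible by q³. -/
theorem qJet_succ_nome {f R : ℂ → ℂ} {n : ℕ} {a b : ℂ}
    (hR : DifferentiableOn ℂ R (Metric.ball 0 1))
    (h : ∀ τ ∈ upperHalfPlaneSet, qJet f τ n = a + b * nome τ + nome τ ^ 3 * R (nome τ)) :
    ∃ R' : ℂ → ℂ, DifferentiableOn ℂ R' (Metric.ball 0 1) ∧
      ∀ τ ∈ upperHalfPlaneSet, qJet f τ (n + 1) = 0 + b * nome τ + nome τ ^ 3 * R' (nome τ) := by
  refine ⟨fun q => 3 * R q + q * deriv R q, ?_, ?_⟩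
  · have := hR.deriv Metric.isOpen_ball
    fun_prop
  refine qJet_succ_eqOn UpperHalfPlane.isOpen_upperHalfPlaneSet h fun τ hτ => ?_
  have hd := (hR.differentiableAt (Metric.isOpen_ball.mem_nhds (nome_mem_ball hτ))).hasDerivAt
  have := hasQDerivAt_comp_nome ((((hasDerivAt_id (nome τ)).const_mul b).const_add a).add
    (((hasDerivAt_id (nome τ)).pow 3).mul hd))
  exact this.congr_deriv (by simp; ring)

theorem differentiableOn_E13 : DifferentiableOn ℂ E13 upperHalfPlaneSet := by
  have hn : DifferentiableOn ℂ nome upperHalfPlaneSet := fun τ _ =>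
    (hasDerivAt_nome τ).differentiableAt.differentiableWithinAt
  have hR : DifferentiableOn ℂ (fun τ => E13Tail (nome τ)) upperHalfPlaneSet :=
    differentiableOn_E13Tail.comp hn fun τ hτ => nome_mem_ball hτ
  have : DifferentiableOn ℂ (fun τ => 1 + 6 * nome τ + nome τ ^ 3 * E13Tail (nome τ))
    upperHalfPlaneSet := by fun_prop
  exact this.congr fun τ hτ => E13_eq hτ

theorem exists_nome_expansions : ∃ S B C : ℂ → ℂ,
    DifferentiableOn ℂ S (Metric.ball 0 1) ∧ DifferentiableOn ℂ B (Metric.ball 0 1) ∧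
    DifferentiableOn ℂ C (Metric.ball 0 1) ∧ ∀ τ ∈ upperHalfPlaneSet,
      E13 τ = 1 + 6 * nome τ + nome τ ^ 2 * S (nome τ) ∧
      bracketTwo 1 (qJet E13 τ) = nome τ * (6 - 36 * nome τ + nome τ ^ 2 * B (nome τ)) ∧
      bracketThree 1 (qJet E13 τ) = nome τ * (6 - 252 * nome τ + nome τ ^ 2 * C (nome τ)) := by
  have h0 : ∀ τ ∈ upperHalfPlaneSet,
      qJet E13 τ 0 = 1 + 6 * nome τ + nome τ ^ 3 * E13Tail (nome τ) := fun τ hτ => E13_eq hτ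
  have d0 := differentiableOn_E13Tail
  obtain ⟨R₁, d1, h1⟩ := qJet_succ_nome d0 h0
  obtain ⟨R₂, d2, h2⟩ := qJet_succ_nome d1 h1
  obtain ⟨R₃, d3, h3⟩ := qJet_succ_nome d2 h2
  refine ⟨fun q => q * E13Tail q,
    fun q => R₂ q + 6 * q * R₂ q + 6 * q * E13Tail q + q ^ 3 * E13Tail q * R₂ q - 24 * q * R₁ q
      - 2 * q ^ 3 * R₁ q ^ 2,
    fun q => R₃ q * (1 + 6 * q + q ^ 3 * E13Tail q) ^ 2 + 216
      + 12 * q * E13Tail q * (1 + 6 * q) + 6 * q ^ 4 * E13Tail q ^ 2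
      - 9 * (36 * (6 + q ^ 2 * E13Tail q) + q * (6 * R₁ q + 6 * R₂ q + q ^ 2 * R₁ q * R₂ q)
        * (1 + 6 * q + q ^ 3 * E13Tail q)) + 12 * (6 + q ^ 2 * R₁ q) ^ 3,
    by fun_prop, by fun_prop, by fun_prop, fun τ hτ => ⟨?_, ?_, ?_⟩⟩
  · rw [E13_eq hτ]; ring
  · simp only [bracketTwo, h0 τ hτ, h1 τ hτ, h2 τ hτ]
    ring
  · simp only [bracketThree, h0 τ hτ, h1 τ hτ, h2 τ hτ, h3 τ hτ]
    ring

end NomeExpansions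

/-! ### The covariants under the Fricke involution -/

section FrickeBrackets

theorem qJet_const_mul {f : ℂ → ℂ} {U : Set ℂ} (hU : IsOpen U) (hf : DifferentiableOn ℂ f U)
    (c : ℂ) (n : ℕ) : EqOn (fun t => qJet (fun s => c * f s) t n) (fun t => c * qJet f t n) U := by
  induction n with
  | zero => exact fun _ _ => rfl
  | succ n ih => exact qJet_succ_eqOn hU ih fun τ hτ => (hasQDerivAt_qJet hf hU hτ n).const_mul c

/-- The matrix of determinant one that acts as `τ ↦ -1 / (3τ)`. -/
noncomputable def frickeMatrix : Matrix (Fin 2) (Fin 2) ℝ := !![0, -1 / √3; √3, 0]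

theorem det_frickeMatrix : frickeMatrix.det = 1 := by
  simp [frickeMatrix, Matrix.det_fin_two]

theorem autFactor_frickeMatrix (τ : ℂ) : autFactor frickeMatrix τ = (√3 : ℝ) * τ := by
  simp [autFactor, frickeMatrix]

theorem sqrt_three_sq : ((√3 : ℝ) : ℂ) ^ 2 = 3 := by
  rw [← Complex.ofReal_pow, Real.sq_sqrt (by norm_num)]; norm_num

theorem moebius_frickeMatrix (τ : ℂ) : moebius frickeMatrix τ = -1 / (3 * τ) := by
  have h3 : ((√3 : ℝ) : ℂ) ≠ 0 := by simp
  rw [moebius, autFactor_frickeMatrix, ← sqrt_three_sq]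
  simp only [frickeMatrix]
  simp
  field_simp

/-- Covariance is applied to -i·E₁,₃; B₂ is quadratic and B₃ cubic in f, so the constants are (-i)²
= -1 and (-i)³ = i. -/
theorem bracket_fricke {τ : ℂ} (hτ : τ ∈ upperHalfPlaneSet) :
    bracketTwo 1 (qJet E13 (-1 / (3 * τ))) =
      -(((√3 : ℝ) * τ) ^ 6 * bracketTwo 1 (qJet E13 τ)) ∧
    bracketThree 1 (qJet E13 (-1 / (3 * τ))) =
      ((√3 : ℝ) * τ) ^ 9 * (Complex.I * bracketThree 1 (qJet E13 τ)) := by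
  have hUo := UpperHalfPlane.isOpen_upperHalfPlaneSet
  have hU : ∀ t ∈ upperHalfPlaneSet, autFactor frickeMatrix t ≠ 0 := fun t ht => by
    rw [autFactor_frickeMatrix]
    have : t ≠ 0 := fun h0 => by
      rw [h0] at ht
      simp [upperHalfPlaneSet] at ht
    simpa using this
  have hf := differentiableOn_E13.const_mul (-Complex.I)
  have hg : ∀ t ∈ upperHalfPlaneSet, E13 (moebius frickeMatrix t) =
      autFactor frickeMatrix t * (-Complex.I * E13 t) := fun t ht => by
    rw [moebius_frickeMatrix, autFactor_frickeMatrix, E13_fricke ht]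
  have e2 := bracketTwo_moebius det_frickeMatrix hUo hU hf hg hτ
  have e3 := bracketThree_moebius det_frickeMatrix hUo hU hf hg hτ
  have hj := fun n => qJet_const_mul hUo differentiableOn_E13 (-Complex.I) n hτ
  simp only at hj
  rw [moebius_frickeMatrix, autFactor_frickeMatrix] at e2 e3
  rw [e2, e3]
  simp only [bracketTwo, bracketThree, hj]
  have hI := Complex.I_sq
  constructor
  · linear_combination (((√3 : ℝ) : ℂ) * τ) ^ 6 * (qJet E13 τ 0 * qJet E13 τ 2
      - 2 * qJet E13 τ 1 ^ 2) * hI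
  · linear_combination -(((√3 : ℝ) : ℂ) * τ) ^ 9 * Complex.I * (qJet E13 τ 0 ^ 2 * qJet E13 τ 3
      - 9 * qJet E13 τ 0 * qJet E13 τ 1 * qJet E13 τ 2 + 12 * qJet E13 τ 1 ^ 3) * hI

end FrickeBrackets

/-! ### The series solves Huber's system -/

section E13Main

theorem bracketTwo_E13_ne_zero : ∀ τ ∈ upperHalfPlaneSet, bracketTwo 1 (qJet E13 τ) ≠ 0 := by
  obtain ⟨S, B, C, dS, dB, dC, h⟩ := exists_nome_expansions
  have hcube : ∀ q ∈ Metric.ball (0 : ℂ) 1, q ^ 3 ∈ Metric.ball (0 : ℂ) 1 := fun q hq => by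
    rw [mem_ball_zero_iff] at hq ⊢
    rw [norm_pow]
    exact pow_lt_one₀ (norm_nonneg _) hq (by norm_num)
  -- This is B₂⁴/(η(τ)²⁴η(3τ)²⁴) as a function of q: both parts have weight 24 and a factor q⁴,
  -- which cancels. The constant value is H(0) = 6⁴, so B₂ cannot vanish.
  set H : ℂ → ℂ := fun q => (6 - 36 * q + q ^ 2 * B q) ^ 4 / (eulerProd q * eulerProd (q ^ 3))
    with hH
  have dH : DifferentiableOn ℂ H (Metric.ball 0 1) := by
    have d1 := differentiableOn_eulerProd
    have d3 : DifferentiableOn ℂ (fun q => eulerProd (q ^ 3)) (Metric.ball 0 1) :=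
      d1.comp (differentiable_pow 3).differentiableOn hcube
    exact DifferentiableOn.div (by fun_prop) (d1.mul d3) fun q hq =>
      mul_ne_zero (eulerProd_ne_zero hq) (eulerProd_ne_zero (hcube q hq))
  have hHτ : ∀ τ : ℂ, 0 < τ.im → H (nome τ) = bracketTwo 1 (qJet E13 τ) ^ 4 /
      (ModularForm.eta τ ^ 24 * ModularForm.eta (3 * τ) ^ 24) := fun τ hτ => by
    have hn := nome_ne_zero τ
    rw [(h τ hτ).2.1, eta_pow_mul_eta_pow hτ, mul_pow,
      mul_div_mul_left _ _ (pow_ne_zero 4 hn)]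
  have hW : ∀ τ : ℂ, 0 < τ.im → ‖H (nome (-1 / (3 * τ)))‖ = ‖H (nome τ)‖ := fun τ hτ => by
    have hne : τ ≠ 0 := fun h0 => by simp [h0] at hτ
    have h24 : (((√3 : ℝ) : ℂ) * τ) ^ 24 = 3 ^ 12 * τ ^ 24 := by
      rw [mul_pow, show ((√3 : ℝ) : ℂ) ^ 24 = (((√3 : ℝ) : ℂ) ^ 2) ^ 12 by ring, sqrt_three_sq]
    rw [hHτ _ (fricke_im_pos hτ), hHτ τ hτ, (bracket_fricke hτ).1, eta_pow_mul_eta_pow_fricke hτ,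
      show (-((((√3 : ℝ) : ℂ) * τ) ^ 6 * bracketTwo 1 (qJet E13 τ))) ^ 4 =
        (((√3 : ℝ) : ℂ) * τ) ^ 24 * bracketTwo 1 (qJet E13 τ) ^ 4 by ring, h24,
      mul_div_mul_left _ _ (mul_ne_zero (by norm_num) (pow_ne_zero _ hne))]
  intro τ hτ h0
  have e := eq_of_norm_fricke_invariant dH hW _ (nome_mem_ball hτ)
  rw [hHτ τ hτ, h0] at e
  norm_num [hH, eulerProd_zero] at e

theorem bracketThree_sq_E13 : ∀ τ ∈ upperHalfPlaneSet,
    bracketThree 1 (qJet E13 τ) ^ 2 + 18 * bracketTwo 1 (qJet E13 τ) ^ 3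
      - E13 τ ^ 6 * bracketTwo 1 (qJet E13 τ) ^ 2 = 0 := by
  obtain ⟨S, B, C, dS, dB, dC, h⟩ := exists_nome_expansions
  set g : ℂ → ℂ := fun q => 6 + q * S q
  set β : ℂ → ℂ := fun q => -36 + q * B q
  -- The following functions are the remainders, divided by q², of f⁶ and of powers of B₂/q and
  -- B₃/q. The lower terms cancel: 36 - 36 = 0 at order zero, and 1296 - 432 - 3888 + 3024 = 0 at
  -- order one.
  set S₆ : ℂ → ℂ := fun q => 6 * S q + 15 * g q ^ 2 + 20 * q * g q ^ 3 + 15 * q ^ 2 * g q ^ 4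
    + 6 * q ^ 3 * g q ^ 5 + q ^ 4 * g q ^ 6
  set B₂ : ℂ → ℂ := fun q => 1296 + 2 * (6 - 36 * q) * B q + q ^ 2 * B q ^ 2
  set B₃ : ℂ → ℂ := fun q => 108 * β q + 18 * q * β q ^ 2 + q ^ 2 * β q ^ 3
  set C₂ : ℂ → ℂ := fun q => 252 ^ 2 + 2 * (6 - 252 * q) * C q + q ^ 2 * C q ^ 2
  set L : ℂ → ℂ := fun q => S₆ q * (36 - 432 * q + q ^ 2 * B₂ q) + B₂ q * (1 + 36 * q)
    - 36 * 432 - 18 * B₃ q - C₂ q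
  have key : ∀ q, (1 + 6 * q + q ^ 2 * S q) ^ 6 * (6 - 36 * q + q ^ 2 * B q) ^ 2
      - 18 * q * (6 - 36 * q + q ^ 2 * B q) ^ 3 - (6 - 252 * q + q ^ 2 * C q) ^ 2
      = q ^ 2 * L q := fun q => by
    simp only [L, S₆, B₂, B₃, C₂, g, β]
    ring
  have dL : DifferentiableOn ℂ L (Metric.ball 0 1) := by
    simp only [L, S₆, B₂, B₃, C₂, g, β]
    fun_prop
  have hb : ∀ q ∈ Metric.ball (0 : ℂ) 1, 6 - 36 * q + q ^ 2 * B q ≠ 0 := fun q hq => by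
    by_cases h0 : q = 0
    · simp [h0]
    obtain ⟨τ, hτ, rfl⟩ := exists_nome_eq hq h0
    have := bracketTwo_E13_ne_zero τ hτ
    rw [(h τ hτ).2.1] at this
    exact right_ne_zero_of_mul this
  -- The numerator of the quotient is O(q⁴) and B₂³ has order exactly q³, so the extra factor q
  -- makes the constant zero.
  set H : ℂ → ℂ := fun q => q * L q / (6 - 36 * q + q ^ 2 * B q) ^ 3 with hH
  have dH : DifferentiableOn ℂ H (Metric.ball 0 1) :=
    DifferentiableOn.div (by fun_prop) (by fun_prop) fun q hq => pow_ne_zero 3 (hb q hq)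
  have hnum : ∀ τ ∈ upperHalfPlaneSet, E13 τ ^ 6 * bracketTwo 1 (qJet E13 τ) ^ 2
      - 18 * bracketTwo 1 (qJet E13 τ) ^ 3 - bracketThree 1 (qJet E13 τ) ^ 2
      = nome τ ^ 4 * L (nome τ) := fun τ hτ => by
    obtain ⟨h0, h2, h3⟩ := h τ hτ
    rw [h0, h2, h3]
    linear_combination nome τ ^ 2 * key (nome τ)
  have hHτ : ∀ τ ∈ upperHalfPlaneSet, H (nome τ) =
      (E13 τ ^ 6 * bracketTwo 1 (qJet E13 τ) ^ 2 - 18 * bracketTwo 1 (qJet E13 τ) ^ 3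
        - bracketThree 1 (qJet E13 τ) ^ 2) / bracketTwo 1 (qJet E13 τ) ^ 3 := fun τ hτ => by
    have hn := nome_ne_zero τ
    rw [hnum τ hτ, (h τ hτ).2.1, mul_pow, show nome τ ^ 4 * L (nome τ) =
      nome τ ^ 3 * (nome τ * L (nome τ)) by ring, mul_div_mul_left _ _ (pow_ne_zero 3 hn)]
  have hW : ∀ τ : ℂ, 0 < τ.im → ‖H (nome (-1 / (3 * τ)))‖ = ‖H (nome τ)‖ := fun τ hτ => by
    have hne : τ ≠ 0 := fun h0 => by simp [h0] at hτ
    have h3 : ((√3 : ℝ) : ℂ) ≠ 0 := by simp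
    have hI := Complex.I_sq
    have hI6 : Complex.I ^ 6 = -1 := by
      rw [show Complex.I ^ 6 = (Complex.I ^ 2) ^ 3 by ring, hI]; norm_num
    rw [hHτ _ (fricke_im_pos hτ), hHτ τ hτ, (bracket_fricke hτ).1, (bracket_fricke hτ).2,
      E13_fricke hτ]
    congr 1
    -- Numerator and denominator both acquire the factor -(√3τ)¹⁸.
    rw [← mul_div_mul_left _ (bracketTwo 1 (qJet E13 τ) ^ 3)
      (neg_ne_zero.2 (pow_ne_zero 18 (mul_ne_zero h3 hne)))]
    congr 1
    · linear_combination (((√3 : ℝ) : ℂ) * τ) ^ 18 * E13 τ ^ 6 *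
        bracketTwo 1 (qJet E13 τ) ^ 2 * hI6
        - (((√3 : ℝ) : ℂ) * τ) ^ 18 * bracketThree 1 (qJet E13 τ) ^ 2 * hI
    · ring
  intro τ hτ
  have e := eq_of_norm_fricke_invariant dH hW _ (nome_mem_ball hτ)
  rw [hHτ τ hτ, hH] at e
  simp only [zero_mul, zero_div] at e
  rw [div_eq_zero_iff, or_iff_left (pow_ne_zero 3 (bracketTwo_E13_ne_zero τ hτ))] at e
  linear_combination -e

theorem isPreconnected_upperHalfPlaneSet : IsPreconnected upperHalfPlaneSet :=
  (convex_halfSpace_im_gt 0).isPreconnected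

/-- The expansion B₃ = 6q + O(q²) is nonzero for small q ≠ 0. -/
theorem exists_bracketThree_E13_ne_zero :
    ∃ τ ∈ upperHalfPlaneSet, bracketThree 1 (qJet E13 τ) ≠ 0 := by
  obtain ⟨S, B, C, -, -, dC, h⟩ := exists_nome_expansions
  have hc : ContinuousAt (fun q => 6 - 252 * q + q ^ 2 * C q) 0 := by
    have := (dC.differentiableAt (Metric.ball_mem_nhds (0 : ℂ) one_pos)).continuousAt
    fun_prop
  have hne : ∀ᶠ q in 𝓝[≠] (0 : ℂ), 6 - 252 * q + q ^ 2 * C q ≠ 0 :=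
    (hc.eventually_ne (by simp)).filter_mono nhdsWithin_le_nhds
  have hball : ∀ᶠ q in 𝓝[≠] (0 : ℂ), q ∈ Metric.ball (0 : ℂ) 1 :=
    Filter.Eventually.filter_mono nhdsWithin_le_nhds (Metric.ball_mem_nhds (0 : ℂ) one_pos)
  obtain ⟨q, ⟨h1, h2⟩, h3⟩ := ((hne.and hball).and self_mem_nhdsWithin).exists
  obtain ⟨τ, hτ, rfl⟩ := exists_nome_eq h2 h3
  exact ⟨τ, hτ, by rw [(h τ hτ).2.2]; exact mul_ne_zero (nome_ne_zero τ) h1⟩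

theorem exists_E13_ne_zero : ∃ τ ∈ upperHalfPlaneSet, E13 τ ≠ 0 := by
  by_contra! h0
  obtain ⟨τ, hτ, h3⟩ := exists_bracketThree_E13_ne_zero
  have h1 := qJet_succ_eqOn (f := E13) (n := 0) (F := fun _ => 0)
    UpperHalfPlane.isOpen_upperHalfPlaneSet h0 fun τ _ => HasQDerivAt.const 0 τ
  have e0 : qJet E13 τ 0 = 0 := h0 τ hτ
  have e1 : qJet E13 τ 1 = 0 := h1 hτ
  exact h3 (by simp [bracketThree, e0, e1])

/-- The series `E13` solves Huber's system. -/
theorem exists_isHuberSolutionOn_E13 :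
    ∃ M N : ℂ → ℂ, IsHuberSolutionOn E13 M N upperHalfPlaneSet :=
  exists_isHuberSolutionOn UpperHalfPlane.isOpen_upperHalfPlaneSet
    isPreconnected_upperHalfPlaneSet differentiableOn_E13 bracketTwo_E13_ne_zero
    bracketThree_sq_E13 exists_E13_ne_zero exists_bracketThree_E13_ne_zero

end E13Main

theorem mainTheorem8 :
    -- the series converges on the upper half-plane, and it solves Huber's system for some `M`, `N`
    (∀ τ ∈ upperHalfPlaneSet, Summable fun p : ℤ × ℤ =>
      Complex.exp (2 * Real.pi * Complex.I * τ * ((p.1 ^ 2 - p.1 * p.2 + p.2 ^ 2 : ℤ) : ℂ))) ∧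
    (∃ M N : ℂ → ℂ, IsHuberSolutionOn E13 M N upperHalfPlaneSet) ∧
    -- elimination of `M` and `N` from Huber's system
    (∀ (U : Set ℂ) (f M N : ℂ → ℂ), IsOpen U → IsHuberSolutionOn f M N U →
      IsSolutionOn ode3 f U) ∧
    -- the third-order ODE: it holds for `E13`, is invariant, and has the stated invariant form
    IsSolutionOn ode3 E13 upperHalfPlaneSet ∧
    IsInvariantODE 1 {A | A.det = 1} ode3 ∧
    (∀ y : ℕ → ℂ, y 0 ≠ 0 →
      (ode3 y = 0 ↔ invJ 1 y ^ 2 + 18 * invI 1 y ^ 3 - invI 1 y ^ 2 = 0)) ∧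
    (∀ τ ∈ upperHalfPlaneSet, E13 τ ≠ 0 →
      invJ 1 (qJet E13 τ) ^ 2 + 18 * invI 1 (qJet E13 τ) ^ 3 - invI 1 (qJet E13 τ) ^ 2 = 0) ∧
    -- the fourth-order ODE is a differential consequence of the third-order one
    (∀ (U : Set ℂ) (f : ℂ → ℂ), IsOpen U → IsPreconnected U → IsSolutionOn ode3 f U →
      (∃ τ ∈ U, f τ ≠ 0 ∧ invI 1 (qJet f τ) ≠ 1 / 18) → IsSolutionOn ode4 f U) ∧
    -- the fourth-order ODE: it holds for `E13`, is invariant, and has the stated invariant form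
    IsSolutionOn ode4 E13 upperHalfPlaneSet ∧
    IsInvariantODE 1 {A | A.det ≠ 0} ode4 ∧
    (∀ y : ℕ → ℂ, y 0 ≠ 0 → bracketTwo 1 y ≠ 0 →
      (ode4 y = 0 ↔ invQ 1 y - 2 * invP 1 y - 36 = 0)) ∧
    (∀ τ ∈ upperHalfPlaneSet, bracketTwo 1 (qJet E13 τ) ≠ 0 ∧
      invQ 1 (qJet E13 τ) - 2 * invP 1 (qJet E13 τ) - 36 = 0) := by
  have hUo := UpperHalfPlane.isOpen_upperHalfPlaneSet
  obtain ⟨M, N, hE⟩ := exists_isHuberSolutionOn_E13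
  have h3 := hE.isSolutionOn_ode3 hUo
  have h4 := hE.isSolutionOn_ode4 hUo
  refine ⟨fun τ hτ => summable_E13 hτ, ⟨M, N, hE⟩,
    fun U f M N hU h => h.isSolutionOn_ode3 hU, h3, isInvariantODE_ode3,
    fun y hy => ode3_eq_zero_iff_invariants hy,
    fun τ hτ hne => (ode3_eq_zero_iff_invariants hne).1 (h3.2 τ hτ),
    fun U f hU hc h hns => h.ode4_of_ode3 hU hc hns, h4, isInvariantODE_ode4,
    fun y hy hB => ode4_eq_zero_iff_invariants hy hB,
    fun τ hτ => ⟨bracketTwo_E13_ne_zero τ hτ, ?_⟩⟩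
  exact invQ_sub_invP_eq_zero (bracketTwo_E13_ne_zero τ hτ) (h4.2 τ hτ)
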